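/- Let $\mathbb R_n$ be the real Clifford algebra generated by $e_1,\dots,e_n$ with $e_i^2=-1$, $e_ie_j=-e_je_i$ $(i\ne j)$, with the Euclidean norm $\|\sum_A y_Ae_A\|^2=\sum_A|y_A|^2$. A function $f:\mathbb R^{n+1}\to\mathbb R_n$ is entire left monogenic if $f\in\mathcal C^1$ and $\partial_{x_0}f+\sum_{i=1}^n e_i\partial_{x_i}f=0$. For such $f$ and $\mathbf m\in\mathbb N_0^n$ let $a_{\mathbf m}=\frac1{\mathbf m!}\partial_{x_1}^{m_1}\cdots\partial_{x_n}^{m_n}f(0)$ be the coefficients of its Taylor expansion $f=\sum_{\mathbf m}V_{\mathbf m}a_{\mathbf m}$. Here the Fueter polynomial $V_{\mathbf m}(\mathbf x)$ is $\frac{\mathbf m!}{|\mathbf m|!}$ times the sum of all products $z_{w_1}\cdots z_{w_{|\mathbf m|}}$, $z_i=x_i-x_0e_i$, over the words $w$ containing each $i$ exactly $m_i$ times. Put $$K_q=\sup_{\|\mathbf x\|\le 1}\Big\|\sum_{|\mathbf m|=q}V_{\mathbf m}(\mathbf x)a_{\mathbf m}\Big\|.$$ A proximate order for the order $\rho$ is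 a differentiable function $\rho(r)\ge 0$, $r\ge 0$, with $\lim_{r\to+\infty}\rho(r)=\rho$ and $\lim_{r\to+\infty}\rho'(r)\,r\ln r=0$. A normalization of it is a proximate order $\hat\rho(r)$ for $\rho$ that agrees with $\rho(r)$ for all $r\ge r_1$, for some $r_1>0$, and such that $r\mapsto r^{\hat\rho(r)}$ is strictly increasing on $(0,+\infty)$ and maps $(0,+\infty)$ onto $(0,+\infty)$; let $\varphi:(0,+\infty)\to(0,+\infty)$ be the inverse function of $r\mapsto r^{\hat\rho(r)}$ and $$G_{\hat\rho,q}=\frac{\varphi(q)^q}{(e\rho)^{q/\rho}}.$$ For $\sigma>0$ let $A_{\rho,\sigma}$ be the set of entire left monogenic $f$ with $\sup_{\mathbf x}\|f(\mathbf x)\|\exp(-\sigma\|\mathbf x\|^{\rho(\|\mathbf x\|)})<+\infty$, and for $\sigma\ge 0$ let $A_{\rho,\sigma+0}=\bigcap_{\epsilon>0}A_{\rho,\sigma+\epsilon}$. **Lemma.** Let $\rho(r)$ be a proximate order for a positive order $\rho>0$, let $\hat\rho(r)$ be a normalization of $\rho(r)$, and let $\sigma\ge 0$. An entire left monogenic function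 $f:\mathbb R^{n+1}\to\mathbb R_n$ belongs to $A_{\rho,\sigma+0}$ if and only if $$\limsup_{q\to\infty}\,(K_qG_{\hat\rho,q})^{\rho/q}\le\sigma .$$ -/

import Mathlib

open Filter Topology

/-- The negative definite quadratic form `v ↦ -(v₁² + ⋯ + vₙ²)` on `ℝⁿ`. -/
noncomputable def negForm (n : ℕ) : QuadraticForm ℝ (Fin n → ℝ) :=
  QuadraticMap.weightedSumSquares ℝ (fun _ : Fin n => (-1 : ℝ))

/-- The real Clifford algebra `ℝ_n` over `n` imaginary units `e₁, …, eₙ`, with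
`eᵢ² = -1` and `eᵢ eⱼ = - eⱼ eᵢ` for `i ≠ j`. -/
abbrev Cl (n : ℕ) : Type := CliffordAlgebra (negForm n)

/-- The imaginary units of `ℝ_n`. -/
noncomputable def imUnit (n : ℕ) (i : Fin n) : Cl n :=
  CliffordAlgebra.ι (negForm n) (Pi.single i 1)

/-- The ordered products `e_A = e_{i₁} ⋯ e_{i_r}`, where `A = {i₁ < ⋯ < i_r}`. -/
noncomputable def cliffordProd (n : ℕ) (A : Finset (Fin n)) : Cl n :=
  ((A.sort (· ≤ ·)).map (imUnit n)).prod

theorem negForm_apply (n : ℕ) (v : Fin n → ℝ) : negForm n v = -∑ i, v i ^ 2 := by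
  have h : negForm n v = ∑ i, (-1 : ℝ) • (v i * v i) :=
    QuadraticMap.weightedSumSquares_apply _ _
  rw [h, ← Finset.sum_neg_distrib]
  exact Finset.sum_congr rfl fun i _ => by simp [sq]

theorem negForm_add (n : ℕ) {v w : Fin n → ℝ} (hvw : ∀ k, v k * w k = 0) :
    negForm n (v + w) = negForm n v + negForm n w := by
  simp only [negForm_apply, ← neg_add, ← Finset.sum_add_distrib, neg_inj]
  refine Finset.sum_congr rfl fun k _ => ?_
  simp only [Pi.add_apply]
  linear_combination 2 * hvw k

theorem single_mul_single (n : ℕ) {i j : Fin n} (h : i ≠ j) (k : Fin n) :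
    (Pi.single i 1 : Fin n → ℝ) k * (Pi.single j 1 : Fin n → ℝ) k = 0 := by
  by_cases hk : k = i
  · subst hk; simp [h]
  · simp [hk]

theorem imUnit_sq (n : ℕ) (i : Fin n) : imUnit n i * imUnit n i = -1 := by
  rw [imUnit, CliffordAlgebra.ι_sq_scalar, negForm_apply,
    Finset.sum_eq_single i (fun j _ hj => by simp [hj]) (by simp)]
  simp

theorem associated_negForm_single (n : ℕ) {i j : Fin n} (h : i ≠ j) :
    QuadraticMap.associated (R := ℝ) (-negForm n) (Pi.single i 1) (Pi.single j 1) = 0 := by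
  rw [QuadraticMap.associated_apply]
  simp [negForm_add n (single_mul_single n h)]

theorem imUnit_anticomm (n : ℕ) {i j : Fin n} (h : i ≠ j) :
    imUnit n i * imUnit n j = -(imUnit n j * imUnit n i) := by
  refine CliffordAlgebra.ι_mul_ι_comm_of_isOrtho ?_
  rw [QuadraticMap.isOrtho_def]
  exact negForm_add n (single_mul_single n h)

theorem equivExterior_prod (n : ℕ) (l : List (Fin n)) (hl : l.Nodup) :
    CliffordAlgebra.equivExterior (negForm n) ((l.map (imUnit n)).prod) =
      (l.map fun i => ExteriorAlgebra.ι ℝ (Pi.single i (1 : ℝ))).prod := by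
  have contr : ∀ (l : List (Fin n)) (i : Fin n), i ∉ l →
      CliffordAlgebra.contractLeft (Q := (0 : QuadraticForm ℝ (Fin n → ℝ)))
        (QuadraticMap.associated (R := ℝ) (-negForm n) (Pi.single i 1))
        ((l.map fun i => ExteriorAlgebra.ι ℝ (Pi.single i (1 : ℝ))).prod) = 0 := by
    intro l i hi
    induction l with
    | nil => exact CliffordAlgebra.contractLeft_one (Q := (0 : QuadraticForm ℝ (Fin n → ℝ))) _
    | cons j l ih =>
      simp only [List.mem_cons, not_or] at hi
      rw [List.map_cons, List.prod_cons]
      refine (CliffordAlgebra.contractLeft_ι_mul (Q := (0 : QuadraticForm ℝ (Fin n → ℝ))) _ _ _).trans ?_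
      rw [associated_negForm_single n hi.1, ih hi.2]
      simp
  induction l with
  | nil => exact CliffordAlgebra.changeForm_one CliffordAlgebra.changeForm.associated_neg_proof
  | cons i l ih =>
    rw [List.nodup_cons] at hl
    rw [List.map_cons, List.prod_cons, List.map_cons, List.prod_cons]
    refine (CliffordAlgebra.changeForm_ι_mul
      CliffordAlgebra.changeForm.associated_neg_proof _ _).trans ?_
    have ih' := ih hl.2
    simp only [CliffordAlgebra.equivExterior, CliffordAlgebra.changeFormEquiv_apply] at ih'
    rw [ih', contr l i hl.1, sub_zero]

theorem equivExterior_cliffordProd (n : ℕ) (A : Finset (Fin n)) :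
    CliffordAlgebra.equivExterior (negForm n) (cliffordProd n A) =
      (Pi.basisFun ℝ (Fin n)).ExteriorAlgebra A := by
  rw [cliffordProd, equivExterior_prod n _ (A.sort_nodup _), ExteriorAlgebra.basis_apply_ofCard _ rfl,
    ← A.listMap_orderEmbOfFin_finRange rfl, List.map_map]
  refine Eq.trans ?_ (ExteriorAlgebra.ιMulti_apply _).symm
  rw [List.ofFn_eq_map]
  simp only [Function.comp_def, Pi.basisFun_apply]
  rfl

/-- The basis `(e_A)_A` of `ℝ_n`, indexed by the subsets of `{1, …, n}`. -/
noncomputable def cliffordBasis (n : ℕ) : Module.Basis (Finset (Fin n)) ℝ (Cl n) :=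
  ((Pi.basisFun ℝ (Fin n)).ExteriorAlgebra).map (CliffordAlgebra.equivExterior (negForm n)).symm

theorem cliffordBasis_apply (n : ℕ) (A : Finset (Fin n)) :
    cliffordBasis n A = cliffordProd n A := by
  rw [cliffordBasis, Module.Basis.map_apply, ← equivExterior_cliffordProd,
    LinearEquiv.symm_apply_apply]

/-- The coordinates `y ↦ (y_A)_A` of a Clifford number `y = ∑_A y_A e_A`, as a Euclidean vector. -/
noncomputable def cliffordCoords (n : ℕ) : Cl n ≃ₗ[ℝ] EuclideanSpace ℝ (Finset (Fin n)) :=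
  (cliffordBasis n).equivFun ≪≫ₗ (WithLp.linearEquiv 2 ℝ (Finset (Fin n) → ℝ)).symm

/-- The Euclidean norm on `ℝ_n`. -/
noncomputable instance instNormedAddCommGroupCl (n : ℕ) : NormedAddCommGroup (Cl n) :=
  NormedAddCommGroup.induced (Cl n) (EuclideanSpace ℝ (Finset (Fin n))) (cliffordCoords n)
    (cliffordCoords n).injective

noncomputable instance instNormedSpaceCl (n : ℕ) : NormedSpace ℝ (Cl n) :=
  NormedSpace.induced ℝ (Cl n) (EuclideanSpace ℝ (Finset (Fin n))) (cliffordCoords n)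

theorem norm_sq_Cl (n : ℕ) (y : Cl n) : ‖y‖ ^ 2 = ∑ A, ((cliffordBasis n).repr y A) ^ 2 := by
  have h : ‖y‖ = ‖cliffordCoords n y‖ := rfl
  rw [h, EuclideanSpace.norm_sq_eq]
  simp [cliffordCoords]

/-- The partial derivative `∂_{x_j}`, `j = 0, …, n`, of functions `ℝ^{n+1} → ℝ_n`. -/
noncomputable def pderivCl {n : ℕ} (j : Fin (n + 1)) (f : EuclideanSpace ℝ (Fin (n + 1)) → Cl n) :
    EuclideanSpace ℝ (Fin (n + 1)) → Cl n :=
  fun x => fderiv ℝ f x (EuclideanSpace.single j 1)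

/-- Entire left monogenic functions: `f` is `C¹` on `ℝ^{n+1}` and
`∂_{x_0} f + ∑ eᵢ ∂_{x_i} f = 0`. -/
def IsLeftMonogenic {n : ℕ} (f : EuclideanSpace ℝ (Fin (n + 1)) → Cl n) : Prop :=
  ContDiff ℝ 1 f ∧ ∀ x, pderivCl 0 f x + ∑ i : Fin n, imUnit n i * pderivCl i.succ f x = 0

/-- The iterated derivative `∂_{x_1}^{m_1} ⋯ ∂_{x_n}^{m_n} f` for `m ∈ ℕ₀ⁿ`. -/
noncomputable def multiDeriv {n : ℕ} (m : Fin n → ℕ)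
    (f : EuclideanSpace ℝ (Fin (n + 1)) → Cl n) : EuclideanSpace ℝ (Fin (n + 1)) → Cl n :=
  (List.finRange n).foldr (fun i g => (pderivCl i.succ)^[m i] g) f

/-- The Taylor coefficients `a_m = ∂_{x_1}^{m_1} ⋯ ∂_{x_n}^{m_n} f (0) / m!` of an entire left
monogenic function, i.e. the coefficients of its expansion `f = ∑ V_m a_m`. -/
noncomputable def taylorCoeff {n : ℕ} (f : EuclideanSpace ℝ (Fin (n + 1)) → Cl n)
    (m : Fin n → ℕ) : Cl n :=
  ((∏ i, (m i).factorial : ℕ) : ℝ)⁻¹ • multiDeriv m f 0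

/-- The Fueter variables `z_i(x) = x_i - x_0 e_i`. -/
noncomputable def fueterVar {n : ℕ} (i : Fin n) (x : EuclideanSpace ℝ (Fin (n + 1))) : Cl n :=
  algebraMap ℝ (Cl n) (x i.succ) - x 0 • imUnit n i

/-- The Fueter polynomial `V_m(x)`: `m! / |m|!` times the sum of the products
`z_{w_1} ⋯ z_{w_{|m|}}` over all words `w` that contain each letter `i` exactly `m_i` times
(so that `V_m(x) = x_1^{m_1} ⋯ x_n^{m_n}` for `x_0 = 0`). -/
noncomputable def fueterPoly {n : ℕ} (m : Fin n → ℕ) (x : EuclideanSpace ℝ (Fin (n + 1))) : Cl n :=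
  (((∏ i, (m i).factorial : ℕ) : ℝ) / ((∑ i, m i).factorial : ℝ)) •
    ∑ w : Fin (∑ i, m i) → Fin n with ∀ i, (Finset.univ.filter fun j => w j = i).card = m i,
      (List.ofFn fun j => fueterVar (w j) x).prod

/-- The homogeneous part `P_q(x) = ∑_{|m| = q} V_m(x) a_m` of the Taylor expansion of `f`. -/
noncomputable def homPart {n : ℕ} (f : EuclideanSpace ℝ (Fin (n + 1)) → Cl n) (q : ℕ)
    (x : EuclideanSpace ℝ (Fin (n + 1))) : Cl n :=
  ∑ m ∈ Finset.piAntidiag (Finset.univ : Finset (Fin n)) q, fueterPoly m x * taylorCoeff f m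

/-- `K_q = sup_{‖x‖ ≤ 1} ‖P_q(x)‖`. -/
noncomputable def supHomPart {n : ℕ} (f : EuclideanSpace ℝ (Fin (n + 1)) → Cl n) (q : ℕ) : ℝ :=
  sSup ((fun x => ‖homPart f q x‖) '' Metric.closedBall 0 1)

/-- `r ↦ p r` (considered for `r ≥ 0` only) is a proximate order for the order `ρ`. -/
structure IsProximateOrder (p : ℝ → ℝ) (ρ : ℝ) : Prop where
  differentiableOn : DifferentiableOn ℝ p (Set.Ici 0)
  nonneg : ∀ r, 0 ≤ r → 0 ≤ p r
  tendsto : Tendsto p atTop (𝓝 ρ)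
  tendsto_deriv : Tendsto (fun r => deriv p r * r * Real.log r) atTop (𝓝 0)

/-- `p'` is a normalization of the proximate order `p` for the order `ρ`. -/
structure IsNormalization (p' p : ℝ → ℝ) (ρ : ℝ) : Prop where
  isProximateOrder : IsProximateOrder p' ρ
  eventually_eq : ∃ r₁ : ℝ, 0 < r₁ ∧ ∀ r, r₁ ≤ r → p' r = p r
  strictMonoOn : StrictMonoOn (fun r : ℝ => r ^ p' r) (Set.Ioi 0)
  image_eq : (fun r : ℝ => r ^ p' r) '' Set.Ioi 0 = Set.Ioi 0

/-- The inverse function `φ : (0, ∞) → (0, ∞)` of `r ↦ r ^ p'(r)`, for `p'` normalized. -/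
noncomputable def growthInv (p' : ℝ → ℝ) : ℝ → ℝ :=
  Function.invFunOn (fun r : ℝ => r ^ p' r) (Set.Ioi 0)

/-- `G_q = φ(q)^q / (e ρ)^{q/ρ}`. -/
noncomputable def growthCoeff (p' : ℝ → ℝ) (ρ : ℝ) (q : ℕ) : ℝ :=
  growthInv p' q ^ q / (Real.exp 1 * ρ) ^ ((q : ℝ) / ρ)

/-- The space `A_{p,σ}`: entire left monogenic functions with
`sup_x ‖f(x)‖ exp(-σ ‖x‖^{p(‖x‖)}) < ∞`. -/
def growthSpace (n : ℕ) (p : ℝ → ℝ) (σ : ℝ) : Set (EuclideanSpace ℝ (Fin (n + 1)) → Cl n) :=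
  {f | IsLeftMonogenic f ∧
    BddAbove (Set.range fun x => ‖f x‖ * Real.exp (-σ * ‖x‖ ^ p ‖x‖))}

/-- The space `A_{p,σ+0} = ⋂_{ε > 0} A_{p,σ+ε}`. -/
def growthSpacePlus (n : ℕ) (p : ℝ → ℝ) (σ : ℝ) :
    Set (EuclideanSpace ℝ (Fin (n + 1)) → Cl n) :=
  ⋂ ε > (0 : ℝ), growthSpace n p (σ + ε)

/-! ### Finite-dimensional topology and paravector algebra of `Cl n`. -/

section CliffordTopology

open MeasureTheory

/-! Write `P_q` for the homogeneous parts of `f` and `φ` for the inverse of `r ↦ r ^ ρ̂(r)`. Two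
facts about monogenic functions reduce the statement to real analysis: `f = ∑ P_q` on the whole
space, and a Cauchy estimate `K_q ≤ K M(R) (tR)^(-q)`, where `M(R)` bounds `‖f‖` on the ball of
radius `R`, `t < 1` is arbitrary, and `K` depends only on `n` and `t`. The loss `t^(-q)` is
harmless, since only `q`-th roots matter and `t` may be taken close to 1.

Both facts come from a Cauchy integral formula in which a smooth cutoff replaces the boundary
(`IsLeftMonogenic.integral_cauchyKer`). It rests on integration by parts against a regularized
kernel whose Cauchy–Riemann derivative is an approximate identity. The formula makes `f` smooth.
Expanding the kernel in powers of `s` along a line `s ↦ s • y` gives a convergent series with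
controlled coefficients (`exists_potential_series`). Its coefficients are the `P_q(y)`, because the
Cauchy–Riemann equation turns each derivative along the line into a sum of Fueter variables times
`∂_{x_i}`, `i ≥ 1` (`IsLeftMonogenic.homPart_eq`).

For the growth part, a proximate order makes `log (r ^ ρ̂(r))` vary with slope close to `ρ` in `log
r` (`IsProximateOrder.exists_log_increment_bounds`). If `f` has type `σ`, the Cauchy estimate at `R
= φ(q) (ρσ)^(-1/ρ)`, the asymptotic minimizer of `exp(σ R^ρ̂(R)) R^(-q)`, bounds `K_q`
(`eventually_homPart_growth_le`). Conversely, bounds on `K_q` and the inequality `log u ≤ u - 1`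
dominate `K_q r^q` by a geometric sequence times `exp(σ' r^ρ̂(r))` for any larger type `σ'`, and
summing over `q` bounds `f` (`mem_growthSpace_of_eventually`). -/

instance finiteDimensional_Cl (n : ℕ) : FiniteDimensional ℝ (Cl n) :=
  (cliffordBasis n).finiteDimensional_of_finite

instance completeSpace_Cl (n : ℕ) : CompleteSpace (Cl n) :=
  FiniteDimensional.complete ℝ (Cl n)

/-- Multiplication of `ℝ_n` as a continuous bilinear map. -/
noncomputable def mulCl (n : ℕ) : Cl n →L[ℝ] Cl n →L[ℝ] Cl n :=
  (LinearMap.mul ℝ (Cl n)).toContinuousBilinearMap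

@[simp]
theorem mulCl_apply {n : ℕ} (a b : Cl n) : mulCl n a b = a * b := rfl

/-- The Euclidean norm on `ℝ_n` need not be submultiplicative; a constant factor suffices for every
estimate below. -/
theorem norm_mul_le_Cl {n : ℕ} (a b : Cl n) : ‖a * b‖ ≤ ‖mulCl n‖ * ‖a‖ * ‖b‖ :=
  (mulCl n).le_opNorm₂ a b

/-- The units `1, e₁, …, eₙ` indexed by the coordinates of `ℝ^{n+1}`. -/
noncomputable def coordUnit (n : ℕ) : Fin (n + 1) → Cl n :=
  Fin.cases 1 (imUnit n)

@[simp] theorem coordUnit_zero (n : ℕ) : coordUnit n 0 = 1 := rfl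

@[simp] theorem coordUnit_succ (n : ℕ) (i : Fin n) : coordUnit n i.succ = imUnit n i := rfl

/-- The Cauchy–Riemann operator `∂_{x_0} + ∑ eᵢ ∂_{x_i}`. -/
noncomputable def diracCl {n : ℕ} (g : EuclideanSpace ℝ (Fin (n + 1)) → Cl n)
    (x : EuclideanSpace ℝ (Fin (n + 1))) : Cl n :=
  ∑ j, coordUnit n j * pderivCl j g x

theorem diracCl_eq {n : ℕ} (g : EuclideanSpace ℝ (Fin (n + 1)) → Cl n)
    (x : EuclideanSpace ℝ (Fin (n + 1))) :
    diracCl g x = pderivCl 0 g x + ∑ i : Fin n, imUnit n i * pderivCl i.succ g x := by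
  simp [diracCl, Fin.sum_univ_succ]

theorem IsLeftMonogenic.diracCl_eq_zero {n : ℕ} {f : EuclideanSpace ℝ (Fin (n + 1)) → Cl n}
    (hf : IsLeftMonogenic f) (x : EuclideanSpace ℝ (Fin (n + 1))) : diracCl f x = 0 := by
  rw [diracCl_eq]; exact hf.2 x

theorem ι_eq_sum (n : ℕ) (v : Fin n → ℝ) :
    CliffordAlgebra.ι (negForm n) v = ∑ i, v i • imUnit n i := by
  conv_lhs => rw [pi_eq_sum_univ' v]
  rw [map_sum]
  refine Finset.sum_congr rfl fun i _ => ?_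
  rw [map_smul, imUnit]

theorem sum_smul_imUnit_sq (n : ℕ) (v : Fin n → ℝ) :
    (∑ i, v i • imUnit n i) * (∑ i, v i • imUnit n i) = algebraMap ℝ (Cl n) (-∑ i, v i ^ 2) := by
  rw [← ι_eq_sum, CliffordAlgebra.ι_sq_scalar, negForm_apply]

/-- The conjugate `x̄ = x_0 - ∑ x_i e_i` of a paravector. -/
noncomputable def paraConj (n : ℕ) : EuclideanSpace ℝ (Fin (n + 1)) →L[ℝ] Cl n :=
  LinearMap.toContinuousLinearMap
    { toFun := fun x => x 0 • (1 : Cl n) - ∑ i : Fin n, x i.succ • imUnit n i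
      map_add' := fun x y => by
        simp only [PiLp.add_apply, add_smul, Finset.sum_add_distrib]; abel
      map_smul' := fun c x => by
        simp only [PiLp.smul_apply, smul_eq_mul, mul_smul, RingHom.id_apply, smul_sub,
          Finset.smul_sum] }

theorem paraConj_apply {n : ℕ} (x : EuclideanSpace ℝ (Fin (n + 1))) :
    paraConj n x = x 0 • (1 : Cl n) - ∑ i : Fin n, x i.succ • imUnit n i := rfl

theorem paraConj_mul_sum {n : ℕ} (x : EuclideanSpace ℝ (Fin (n + 1))) :
    paraConj n x * ∑ j, x j • coordUnit n j = (‖x‖ ^ 2) • (1 : Cl n) := by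
  rw [Fin.sum_univ_succ, paraConj_apply, EuclideanSpace.norm_sq_eq, Fin.sum_univ_succ]
  simp only [coordUnit_zero, coordUnit_succ, Real.norm_eq_abs, sq_abs]
  have h := sum_smul_imUnit_sq n fun i => x i.succ
  rw [Algebra.algebraMap_eq_smul_one] at h
  rw [sub_mul, mul_add, mul_add, h]
  simp only [smul_mul_assoc, one_mul, mul_smul_comm, mul_one, neg_smul, add_smul, smul_smul, sq]
  abel

theorem sum_paraConj_single_mul (n : ℕ) :
    ∑ j, paraConj n (EuclideanSpace.single j 1) * coordUnit n j = ((n : ℝ) + 1) • (1 : Cl n) := by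
  have h0 : paraConj n (EuclideanSpace.single 0 1) = 1 := by
    rw [paraConj_apply]
    simp
  have h1 : ∀ i : Fin n, paraConj n (EuclideanSpace.single i.succ 1) = -imUnit n i := by
    intro i
    rw [paraConj_apply, Finset.sum_eq_single i]
    · simp
    · intro j _ hj
      simp [hj]
    · simp
  rw [Fin.sum_univ_succ, h0]
  simp only [h1, coordUnit_zero, coordUnit_succ, neg_mul, imUnit_sq, neg_neg, mul_one,
    Finset.sum_const, Finset.card_univ, Fintype.card_fin]
  rw [add_smul, one_smul, Nat.cast_smul_eq_nsmul, add_comm]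

end CliffordTopology

/-! ### The Cauchy kernel and the Cauchy–Pompeiu formula. -/

section CauchyPompeiu

open MeasureTheory

/-- The dimension `n + 1` as a real number, halved and negated: the exponent of `‖x‖ ^ 2` in the
Cauchy kernel. -/
noncomputable def kerExp (n : ℕ) : ℝ := -(((n : ℝ) + 1) / 2)

/-- The Cauchy kernel `x̄ / ‖x‖ ^ (n + 1)`. -/
noncomputable def cauchyKer {n : ℕ} (x : EuclideanSpace ℝ (Fin (n + 1))) : Cl n :=
  (‖x‖ ^ 2) ^ kerExp n • paraConj n x

/-- A smooth regularization of the Cauchy kernel. -/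
noncomputable def regKer {n : ℕ} (c : ℝ) (x : EuclideanSpace ℝ (Fin (n + 1))) : Cl n :=
  (1 + c ^ 2 * ‖x‖ ^ 2) ^ kerExp n • paraConj n x

theorem hasFDerivAt_regKer {n : ℕ} (c : ℝ) (x : EuclideanSpace ℝ (Fin (n + 1))) :
    HasFDerivAt (regKer (n := n) c)
      ((1 + c ^ 2 * ‖x‖ ^ 2) ^ kerExp n • paraConj n +
        ((kerExp n * (1 + c ^ 2 * ‖x‖ ^ 2) ^ (kerExp n - 1)) •
          (c ^ 2 • (2 • innerSL ℝ x))).smulRight (paraConj n x)) x := by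
  have h1 : HasFDerivAt (fun x : EuclideanSpace ℝ (Fin (n + 1)) => 1 + c ^ 2 * ‖x‖ ^ 2)
      (c ^ 2 • (2 • innerSL ℝ x)) x :=
    (((hasStrictFDerivAt_norm_sq x).hasFDerivAt).const_mul (c ^ 2)).const_add 1
  have h2 := h1.rpow_const (p := kerExp n) (Or.inl (by positivity))
  exact h2.smul (paraConj n).hasFDerivAt

theorem contDiff_regKer {n : ℕ} (c : ℝ) : ContDiff ℝ 1 (regKer (n := n) c) := by
  unfold regKer
  refine ContDiff.smul (ContDiff.rpow_const_of_ne ?_ fun x => by positivity) (paraConj n).contDiff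
  exact contDiff_const.add (contDiff_const.mul (contDiff_norm_sq ℝ))

theorem inner_single_eq {n : ℕ} (x : EuclideanSpace ℝ (Fin (n + 1))) (j : Fin (n + 1)) :
    inner ℝ x (EuclideanSpace.single j 1) = x j := by
  simp [EuclideanSpace.inner_single_right]

/-- With `A = 1 + c²‖x‖²` and `k = -(n+1)/2`, the two terms of the product rule are `(n+1) A^k` and
`2k c²‖x‖² A^(k-1)`. As `2k = -(n+1)`, they combine to `(n+1) A^(k-1) (A - c²‖x‖²)`. This positive
bump concentrates at 0 as `c → ∞`. -/
theorem sum_fderiv_regKer_mul {n : ℕ} (c : ℝ) (x : EuclideanSpace ℝ (Fin (n + 1))) :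
    ∑ j, fderiv ℝ (regKer (n := n) c) x (EuclideanSpace.single j 1) * coordUnit n j =
      (((n : ℝ) + 1) * (1 + c ^ 2 * ‖x‖ ^ 2) ^ (kerExp n - 1)) • (1 : Cl n) := by
  rw [(hasFDerivAt_regKer c x).fderiv]
  have h : ∀ j, ((1 + c ^ 2 * ‖x‖ ^ 2) ^ kerExp n • paraConj n +
        ((kerExp n * (1 + c ^ 2 * ‖x‖ ^ 2) ^ (kerExp n - 1)) •
          (c ^ 2 • (2 • innerSL ℝ x))).smulRight (paraConj n x)) (EuclideanSpace.single j 1) *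
          coordUnit n j =
      (1 + c ^ 2 * ‖x‖ ^ 2) ^ kerExp n • (paraConj n (EuclideanSpace.single j 1) * coordUnit n j) +
      (kerExp n * (1 + c ^ 2 * ‖x‖ ^ 2) ^ (kerExp n - 1) * (c ^ 2 * 2)) •
        (paraConj n x * (x j • coordUnit n j)) := by
    intro j
    simp only [_root_.add_apply, _root_.smul_apply,
      ContinuousLinearMap.smulRight_apply, innerSL_apply_apply, inner_single_eq, smul_eq_mul,
      add_mul, smul_mul_assoc, mul_smul_comm, smul_smul, nsmul_eq_mul]
    congr 2
    push_cast
    ring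
  rw [Finset.sum_congr rfl fun j _ => h j, Finset.sum_add_distrib, ← Finset.smul_sum,
    ← Finset.smul_sum, ← Finset.mul_sum, paraConj_mul_sum, sum_paraConj_single_mul, smul_smul,
    smul_smul, ← add_smul]
  congr 1
  have hpos : 0 < 1 + c ^ 2 * ‖x‖ ^ 2 := by positivity
  have : (1 + c ^ 2 * ‖x‖ ^ 2) ^ kerExp n =
      (1 + c ^ 2 * ‖x‖ ^ 2) * (1 + c ^ 2 * ‖x‖ ^ 2) ^ (kerExp n - 1) := by
    rw [Real.rpow_sub_one hpos.ne']
    field_simp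
  rw [this, kerExp]
  ring

/-- The normalizing constant of the Cauchy kernel (the surface area of the unit sphere). -/
noncomputable def kerConst (n : ℕ) : ℝ :=
  ∫ x : EuclideanSpace ℝ (Fin (n + 1)), ((n : ℝ) + 1) * (1 + ‖x‖ ^ 2) ^ (kerExp n - 1)

theorem integrable_bump (n : ℕ) :
    Integrable fun x : EuclideanSpace ℝ (Fin (n + 1)) =>
      ((n : ℝ) + 1) * (1 + ‖x‖ ^ 2) ^ (kerExp n - 1) := by
  have h := integrable_rpow_neg_one_add_norm_sq (E := EuclideanSpace ℝ (Fin (n + 1)))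
    (μ := volume) (r := (n : ℝ) + 3) (by simp)
  convert h.const_mul ((n : ℝ) + 1) using 4
  rw [kerExp]; ring

theorem kerConst_pos (n : ℕ) : 0 < kerConst n := by
  refine integral_pos_of_integrable_nonneg_nonzero (x := 0) ?_ (integrable_bump n) ?_ ?_
  · refine continuous_const.mul (Continuous.rpow_const (by fun_prop) fun x => Or.inl ?_)
    positivity
  · intro x
    positivity
  · simp; positivity

theorem tendsto_integral_bump {n : ℕ} {g : EuclideanSpace ℝ (Fin (n + 1)) → Cl n}
    (hg : Continuous g) (hsupp : HasCompactSupport g) :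
    Tendsto (fun c : ℝ => ∫ x, (c ^ (n + 1) *
      (((n : ℝ) + 1) * (1 + c ^ 2 * ‖x‖ ^ 2) ^ (kerExp n - 1))) • g x) atTop
      (𝓝 (kerConst n • g 0)) := by
  have hk := kerConst_pos n
  have h := tendsto_integral_comp_smul_smul_of_integrable
    (F := EuclideanSpace ℝ (Fin (n + 1))) (μ := volume)
    (φ := fun x => (kerConst n)⁻¹ * (((n : ℝ) + 1) * (1 + ‖x‖ ^ 2) ^ (kerExp n - 1)))
    (fun x => by positivity) ?_ ?_ (hg.integrable_of_hasCompactSupport hsupp) hg.continuousAt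
  · have h' := h.const_smul (kerConst n)
    refine h'.congr fun c => ?_
    rw [← integral_smul]
    refine integral_congr_ae (Eventually.of_forall fun x => ?_)
    simp only [smul_smul, norm_smul, mul_pow, Real.norm_eq_abs, sq_abs, finrank_euclideanSpace,
      Fintype.card_fin]
    congr 1
    field_simp
  · rw [integral_const_mul]
    exact inv_mul_cancel₀ hk.ne'
  -- Decay condition for an approximate identity: the bump is of order `‖x‖^(-(n+3))`, which beats
  -- `‖x‖^(n+1)` by a factor `‖x‖^(-2)`.
  · have hlim : Tendsto (fun x : EuclideanSpace ℝ (Fin (n + 1)) =>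
        (kerConst n)⁻¹ * ((n : ℝ) + 1) * (‖x‖ ^ 2)⁻¹) (Bornology.cobounded _) (𝓝 0) := by
      have := ((tendsto_pow_atTop (α := ℝ) two_ne_zero).comp
        (tendsto_norm_cobounded_atTop (E := EuclideanSpace ℝ (Fin (n + 1))))).inv_tendsto_atTop
      simpa using this.const_mul ((kerConst n)⁻¹ * ((n : ℝ) + 1))
    refine squeeze_zero' (Eventually.of_forall fun x => by positivity) ?_ hlim
    filter_upwards [(tendsto_norm_cobounded_atTop
      (E := EuclideanSpace ℝ (Fin (n + 1)))).eventually_gt_atTop 0] with x hx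
    have h1 : (1 + ‖x‖ ^ 2) ^ (kerExp n - 1) ≤ (‖x‖ ^ 2) ^ (kerExp n - 1) := by
      refine Real.rpow_le_rpow_of_nonpos (by positivity) (by linarith) ?_
      rw [kerExp]
      have : (0 : ℝ) ≤ ((n : ℝ) + 1) / 2 := by positivity
      linarith
    have h2 : ‖x‖ ^ (n + 1) * (‖x‖ ^ 2) ^ (kerExp n - 1) = (‖x‖ ^ 2)⁻¹ := by
      rw [← Real.rpow_natCast, ← Real.rpow_natCast, ← Real.rpow_mul hx.le, ← Real.rpow_add hx,
        ← Real.rpow_neg hx.le, kerExp]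
      congr 1
      push_cast
      ring
    rw [finrank_euclideanSpace, Fintype.card_fin]
    calc ‖x‖ ^ (n + 1) * ((kerConst n)⁻¹ * (((n : ℝ) + 1) * (1 + ‖x‖ ^ 2) ^ (kerExp n - 1)))
        ≤ ‖x‖ ^ (n + 1) * ((kerConst n)⁻¹ * (((n : ℝ) + 1) * (‖x‖ ^ 2) ^ (kerExp n - 1))) := by
          gcongr
      _ = (kerConst n)⁻¹ * ((n : ℝ) + 1) * (‖x‖ ^ (n + 1) * (‖x‖ ^ 2) ^ (kerExp n - 1)) := by ring
      _ = _ := by rw [h2]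

theorem continuous_pderivCl {n : ℕ} {g : EuclideanSpace ℝ (Fin (n + 1)) → Cl n}
    (hg : ContDiff ℝ 1 g) (j : Fin (n + 1)) : Continuous (pderivCl j g) :=
  (hg.continuous_fderiv one_ne_zero).clm_apply continuous_const

theorem continuous_diracCl {n : ℕ} {g : EuclideanSpace ℝ (Fin (n + 1)) → Cl n}
    (hg : ContDiff ℝ 1 g) : Continuous (diracCl g) :=
  continuous_finsetSum _ fun j _ => ((mulCl n (coordUnit n j)).continuous).comp
    (continuous_pderivCl hg j)

theorem HasCompactSupport.pderivCl {n : ℕ} {g : EuclideanSpace ℝ (Fin (n + 1)) → Cl n}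
    (hg : HasCompactSupport g) (j : Fin (n + 1)) : HasCompactSupport (pderivCl j g) :=
  (hg.fderiv ℝ).comp_left (g := fun L : EuclideanSpace ℝ (Fin (n + 1)) →L[ℝ] Cl n =>
    L (EuclideanSpace.single j 1)) rfl

theorem integral_regKer_mul_diracCl {n : ℕ} {g : EuclideanSpace ℝ (Fin (n + 1)) → Cl n}
    (hg : ContDiff ℝ 1 g) (hsupp : HasCompactSupport g) (c : ℝ) :
    ∫ x, regKer c x * diracCl g x =
      -∫ x, (((n : ℝ) + 1) * (1 + c ^ 2 * ‖x‖ ^ 2) ^ (kerExp n - 1)) • g x := by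
  have hr := contDiff_regKer (n := n) c
  have hcont : ∀ {a b : EuclideanSpace ℝ (Fin (n + 1)) → Cl n}, Continuous a → Continuous b →
      Continuous fun x => a x * b x := fun ha hb =>
    ((mulCl n).continuous.comp ha).clm_apply hb
  have hint : ∀ {a b : EuclideanSpace ℝ (Fin (n + 1)) → Cl n}, Continuous a → Continuous b →
      HasCompactSupport b → Integrable fun x => a x * b x := fun ha hb hc =>
    (hcont ha hb).integrable_of_hasCompactSupport hc.mul_left
  -- The unit is kept to the left of `g` and attached to the kernel, because multiplication does not
  -- commute.
  have parts : ∀ j, ∫ x, regKer c x * coordUnit n j * pderivCl j g x =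
      -∫ x, fderiv ℝ (regKer c) x (EuclideanSpace.single j 1) * coordUnit n j * g x := by
    intro j
    have hd : ∀ x, HasFDerivAt (fun x => regKer c x * coordUnit n j)
        (((mulCl n).flip (coordUnit n j)).comp (fderiv ℝ (regKer c) x)) x := fun x =>
      ((mulCl n).flip (coordUnit n j)).hasFDerivAt.comp x
        (hr.differentiable one_ne_zero x).hasFDerivAt
    refine integral_bilinear_hasFDerivAt_right_eq_neg_left_of_integrable (B := mulCl n)
      (f := fun x => regKer c x * coordUnit n j) (g := g)
      (f' := fun x => ((mulCl n).flip (coordUnit n j)).comp (fderiv ℝ (regKer c) x))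
      (g' := fderiv ℝ g) (v := EuclideanSpace.single j 1) ?_ ?_ ?_ ?_ ?_
    · refine hint ?_ hg.continuous hsupp
      exact ((mulCl n).flip (coordUnit n j)).continuous.comp
        ((hr.continuous_fderiv one_ne_zero).clm_apply continuous_const)
    · exact hint (hcont hr.continuous continuous_const) (continuous_pderivCl hg j)
        (hsupp.pderivCl j)
    · exact hint (hcont hr.continuous continuous_const) hg.continuous hsupp
    · exact fun x _ => hd x
    · exact fun x _ => (hg.differentiable one_ne_zero x).hasFDerivAt
  have e1 : ∀ x, regKer c x * diracCl g x =
      ∑ j, regKer c x * coordUnit n j * pderivCl j g x := fun x => by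
    simp only [diracCl, Finset.mul_sum, mul_assoc]
  have e2 : ∀ x, (((n : ℝ) + 1) * (1 + c ^ 2 * ‖x‖ ^ 2) ^ (kerExp n - 1)) • g x =
      ∑ j, fderiv ℝ (regKer c) x (EuclideanSpace.single j 1) * coordUnit n j * g x := fun x => by
    rw [← Finset.sum_mul, sum_fderiv_regKer_mul, smul_mul_assoc, one_mul]
  simp only [e1, e2]
  rw [integral_finsetSum, integral_finsetSum, ← Finset.sum_neg_distrib]
  · exact Finset.sum_congr rfl fun j _ => parts j
  · intro j _
    refine hint ?_ hg.continuous hsupp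
    exact ((mulCl n).flip (coordUnit n j)).continuous.comp
      ((hr.continuous_fderiv one_ne_zero).clm_apply continuous_const)
  · intro j _
    exact hint (hcont hr.continuous continuous_const) (continuous_pderivCl hg j)
      (hsupp.pderivCl j)

theorem HasCompactSupport.diracCl {n : ℕ} {g : EuclideanSpace ℝ (Fin (n + 1)) → Cl n}
    (hg : HasCompactSupport g) : HasCompactSupport (diracCl g) :=
  (hg.fderiv ℝ).comp_left (g := fun L : EuclideanSpace ℝ (Fin (n + 1)) →L[ℝ] Cl n =>
    ∑ j, coordUnit n j * L (EuclideanSpace.single j 1)) (by simp)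

/-- The Cauchy–Pompeiu formula at `0`, for compactly supported functions that are monogenic
near `0`. -/
theorem integral_cauchyKer_mul_diracCl {n : ℕ} {g : EuclideanSpace ℝ (Fin (n + 1)) → Cl n}
    (hg : ContDiff ℝ 1 g) (hsupp : HasCompactSupport g) {δ : ℝ} (hδ : 0 < δ)
    (hzero : ∀ x, ‖x‖ < δ → diracCl g x = 0) :
    ∫ x, cauchyKer x * diracCl g x = -(kerConst n • g 0) := by
  have hexp : kerExp n ≤ 0 := by
    rw [kerExp]
    have : (0 : ℝ) ≤ ((n : ℝ) + 1) / 2 := by positivity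
    linarith
  have lim1 := (tendsto_integral_bump hg.continuous hsupp).neg
  -- After multiplication by `c^(n+1)` the regularized kernel is the Cauchy kernel with `‖x‖²`
  -- replaced by `c⁻² + ‖x‖²`.
  have hscal : ∀ c : ℝ, 0 < c → ∀ x : EuclideanSpace ℝ (Fin (n + 1)),
      c ^ (n + 1) * (1 + c ^ 2 * ‖x‖ ^ 2) ^ kerExp n = ((c ^ 2)⁻¹ + ‖x‖ ^ 2) ^ kerExp n := by
    intro c hc x
    have : 1 + c ^ 2 * ‖x‖ ^ 2 = c ^ 2 * ((c ^ 2)⁻¹ + ‖x‖ ^ 2) := by field_simp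
    rw [this, Real.mul_rpow (by positivity) (by positivity), ← mul_assoc]
    have : c ^ (n + 1) * (c ^ 2) ^ kerExp n = 1 := by
      rw [← Real.rpow_natCast, ← Real.rpow_natCast, ← Real.rpow_mul hc.le, ← Real.rpow_add hc,
        kerExp]
      convert Real.rpow_zero c using 2
      push_cast
      ring
    rw [this, one_mul]
  have lim2 : Tendsto (fun c : ℝ => ∫ x, c ^ (n + 1) • (regKer c x * diracCl g x)) atTop
      (𝓝 (∫ x, cauchyKer x * diracCl g x)) := by
    have hcd := continuous_diracCl hg
    -- The singularity is invisible because `diracCl g` vanishes for `‖x‖ < δ`; elsewhere the scalar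
    -- factor is at most `(δ²)^kerExp n`.
    refine tendsto_integral_filter_of_dominated_convergence
      (fun x => (δ ^ 2) ^ kerExp n * ‖paraConj n x * diracCl g x‖) ?_ ?_ ?_ ?_
    · refine Eventually.of_forall fun c => Continuous.aestronglyMeasurable ?_
      have hc : Continuous fun x => regKer c x * diracCl g x :=
        ((mulCl n).continuous.comp (contDiff_regKer c).continuous).clm_apply hcd
      exact hc.const_smul (c ^ (n + 1))
    · filter_upwards [eventually_gt_atTop 0] with c hc
      refine Eventually.of_forall fun x => ?_
      rw [regKer, smul_mul_assoc, smul_smul, hscal c hc, norm_smul, Real.norm_of_nonneg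
        (by positivity)]
      by_cases hx : ‖x‖ < δ
      · simp [hzero x hx]
      · refine mul_le_mul_of_nonneg_right ?_ (norm_nonneg _)
        refine Real.rpow_le_rpow_of_nonpos (by positivity) ?_ hexp
        have : δ ^ 2 ≤ ‖x‖ ^ 2 := by gcongr; exact not_lt.mp hx
        have : 0 < (c ^ 2)⁻¹ := by positivity
        linarith
    · refine Integrable.const_mul (Integrable.norm ?_) _
      refine Continuous.integrable_of_hasCompactSupport ?_ (HasCompactSupport.mul_left ?_)
      · exact ((mulCl n).continuous.comp (paraConj n).continuous).clm_apply hcd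
      · exact hsupp.diracCl
    · refine Eventually.of_forall fun x => ?_
      by_cases hx : ‖x‖ < δ
      · simp [hzero x hx]
      · have hx' : 0 < ‖x‖ := hδ.trans_le (not_lt.mp hx)
        have l1 : Tendsto (fun c : ℝ => (c ^ 2)⁻¹ + ‖x‖ ^ 2) atTop (𝓝 (0 + ‖x‖ ^ 2)) :=
          ((tendsto_pow_atTop two_ne_zero).inv_tendsto_atTop).add_const _
        rw [zero_add] at l1
        have l2 := (l1.rpow_const (p := kerExp n) (Or.inl (by positivity))).smul_const
          (paraConj n x * diracCl g x)
        rw [cauchyKer, smul_mul_assoc]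
        refine l2.congr' ?_
        filter_upwards [eventually_gt_atTop 0] with c hc
        rw [regKer, smul_mul_assoc, smul_smul, hscal c hc]
  refine tendsto_nhds_unique lim2 (lim1.congr fun c => ?_)
  rw [integral_smul, integral_regKer_mul_diracCl hg hsupp, smul_neg, ← integral_smul]
  simp only [smul_smul]

end CauchyPompeiu

/-! ### Cauchy formula with a smooth cutoff; smoothness of monogenic functions. -/

section Cutoff

open MeasureTheory
open scoped ContDiff Convolution

/-- The gradient of a scalar function as a paravector. -/
noncomputable def gradCl {n : ℕ} (ψ : EuclideanSpace ℝ (Fin (n + 1)) → ℝ)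
    (x : EuclideanSpace ℝ (Fin (n + 1))) : Cl n :=
  ∑ j, fderiv ℝ ψ x (EuclideanSpace.single j 1) • coordUnit n j

theorem diracCl_smul {n : ℕ} {ψ : EuclideanSpace ℝ (Fin (n + 1)) → ℝ}
    {f : EuclideanSpace ℝ (Fin (n + 1)) → Cl n} {x : EuclideanSpace ℝ (Fin (n + 1))}
    (hψ : DifferentiableAt ℝ ψ x) (hf : DifferentiableAt ℝ f x) :
    diracCl (fun y => ψ y • f y) x = gradCl ψ x * f x + ψ x • diracCl f x := by
  simp only [diracCl, gradCl, pderivCl, Finset.sum_mul, Finset.smul_sum]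
  rw [← Finset.sum_add_distrib, (hψ.hasFDerivAt.fun_smul hf.hasFDerivAt).fderiv]
  refine Finset.sum_congr rfl fun j _ => ?_
  simp only [_root_.add_apply, _root_.smul_apply, ContinuousLinearMap.smulRight_apply, mul_add,
    mul_smul_comm, smul_mul_assoc]
  rw [add_comm]

theorem IsLeftMonogenic.comp_add_right {n : ℕ} {f : EuclideanSpace ℝ (Fin (n + 1)) → Cl n}
    (hf : IsLeftMonogenic f) (y : EuclideanSpace ℝ (Fin (n + 1))) :
    IsLeftMonogenic fun x => f (x + y) := by
  refine ⟨hf.1.comp (contDiff_id.add contDiff_const), fun x => ?_⟩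
  simpa only [pderivCl, fderiv_comp_add_right] using hf.2 (x + y)

theorem continuous_gradCl {n : ℕ} {ψ : EuclideanSpace ℝ (Fin (n + 1)) → ℝ}
    (hψ : ContDiff ℝ 1 ψ) : Continuous (gradCl ψ) :=
  continuous_finsetSum _ fun _ _ =>
    ((hψ.continuous_fderiv one_ne_zero).clm_apply continuous_const).smul continuous_const

theorem contDiff_gradCl {n : ℕ} {ψ : EuclideanSpace ℝ (Fin (n + 1)) → ℝ}
    (hψ : ContDiff ℝ ∞ ψ) : ContDiff ℝ ∞ (gradCl ψ) :=
  ContDiff.sum fun _ _ =>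
    ((hψ.fderiv_right (m := ∞) (by simp)).clm_apply contDiff_const).smul contDiff_const

/-- The Cauchy integral formula with a smooth cutoff instead of a boundary. -/
theorem IsLeftMonogenic.integral_cauchyKer {n : ℕ} {f : EuclideanSpace ℝ (Fin (n + 1)) → Cl n}
    (hf : IsLeftMonogenic f) {ψ : EuclideanSpace ℝ (Fin (n + 1)) → ℝ} (hψ : ContDiff ℝ 1 ψ)
    (hsupp : HasCompactSupport ψ) {y : EuclideanSpace ℝ (Fin (n + 1))} (hy : ψ y = 1) {δ : ℝ}
    (hδ : 0 < δ) (hgrad : ∀ x, ‖x - y‖ < δ → gradCl ψ x = 0) :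
    ∫ x, cauchyKer (x - y) * (gradCl ψ x * f x) = -(kerConst n • f y) := by
  have hfy := hf.comp_add_right y
  have hψy : ContDiff ℝ 1 fun x => ψ (x + y) := hψ.comp (contDiff_id.add contDiff_const)
  have hd : ∀ x, diracCl (fun x => ψ (x + y) • f (x + y)) x = gradCl ψ (x + y) * f (x + y) := by
    intro x
    rw [diracCl_smul (hψy.differentiable one_ne_zero x) (hfy.1.differentiable one_ne_zero x),
      hfy.diracCl_eq_zero, smul_zero, add_zero]
    simp only [gradCl, fderiv_comp_add_right]
  have h := integral_cauchyKer_mul_diracCl (g := fun x => ψ (x + y) • f (x + y))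
    (hψy.smul hfy.1) ?_ hδ ?_
  · simp only [hd, zero_add, hy, one_smul] at h
    rw [← h, ← integral_add_right_eq_self _ y]
    simp only [add_sub_cancel_right]
  · exact (hsupp.comp_homeomorph (Homeomorph.addRight y)).smul_right
  · intro x hx
    rw [hd, hgrad (x + y) (by simpa using hx), zero_mul]

theorem gradCl_bump_eq_zero {n : ℕ} (b : ContDiffBump (0 : EuclideanSpace ℝ (Fin (n + 1))))
    {x : EuclideanSpace ℝ (Fin (n + 1))} (hx : ‖x‖ < b.rIn) : gradCl b x = 0 := by
  have : (b : EuclideanSpace ℝ (Fin (n + 1)) → ℝ) =ᶠ[𝓝 x] fun _ => (1 : ℝ) := by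
    filter_upwards [Metric.isOpen_ball.mem_nhds (show x ∈ Metric.ball 0 b.rIn by simpa using hx)]
      with z hz
    exact b.one_of_mem_closedBall (Metric.ball_subset_closedBall hz)
  simp [gradCl, this.fderiv_eq]

theorem gradCl_bump_eq_zero_of_lt {n : ℕ} (b : ContDiffBump (0 : EuclideanSpace ℝ (Fin (n + 1))))
    {x : EuclideanSpace ℝ (Fin (n + 1))} (hx : b.rOut < ‖x‖) : gradCl b x = 0 := by
  have : (b : EuclideanSpace ℝ (Fin (n + 1)) → ℝ) =ᶠ[𝓝 x] fun _ => (0 : ℝ) := by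
    filter_upwards [Metric.isClosed_closedBall.isOpen_compl.mem_nhds
      (show x ∈ (Metric.closedBall 0 b.rOut)ᶜ by simpa using hx)] with z hz
    refine b.zero_of_le_dist ?_
    have hz' : b.rOut < ‖z‖ := by simpa using hz
    simpa using hz'.le
  simp [gradCl, this.fderiv_eq]

/-- The gradient of the bump is zero on a neighbourhood of the only singularity of the kernel. -/
theorem contDiff_cauchyKer_mul_gradCl {n : ℕ}
    (b : ContDiffBump (0 : EuclideanSpace ℝ (Fin (n + 1)))) :
    ContDiff ℝ ∞ fun x => cauchyKer x * gradCl b x := by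
  rw [contDiff_iff_contDiffAt]
  intro x
  by_cases hx : x = 0
  · subst hx
    have : (fun x => cauchyKer x * gradCl b x) =ᶠ[𝓝 0] fun _ => 0 := by
      filter_upwards [Metric.ball_mem_nhds 0 b.rIn_pos] with z hz
      rw [gradCl_bump_eq_zero b (by simpa using hz), mul_zero]
    exact contDiffAt_const.congr_of_eventuallyEq this
  · have h1 : ContDiffAt ℝ ∞ (cauchyKer (n := n)) x :=
      ((contDiff_norm_sq ℝ).contDiffAt.rpow_const_of_ne (by simpa using hx)).smul
        (paraConj n).contDiff.contDiffAt
    have h2 : ContDiffAt ℝ ∞ (gradCl b) x := (contDiff_gradCl b.contDiff).contDiffAt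
    exact (((mulCl n).contDiff.contDiffAt.comp x h1)).clm_apply h2

/-- Left monogenic functions are smooth. -/
theorem IsLeftMonogenic.contDiff {n : ℕ} {f : EuclideanSpace ℝ (Fin (n + 1)) → Cl n}
    (hf : IsLeftMonogenic f) : ContDiff ℝ ∞ f := by
  let b : ContDiffBump (0 : EuclideanSpace ℝ (Fin (n + 1))) := ⟨1, 2, by norm_num, by norm_num⟩
  let k : EuclideanSpace ℝ (Fin (n + 1)) → Cl n := fun t => cauchyKer (-t) * gradCl b (-t)
  have hk : ContDiff ℝ ∞ k := (contDiff_cauchyKer_mul_gradCl b).comp contDiff_neg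
  have hksupp : HasCompactSupport k := by
    refine HasCompactSupport.of_support_subset_isCompact
      (isCompact_closedBall (0 : EuclideanSpace ℝ (Fin (n + 1))) 2) fun x hx => ?_
    by_contra hx'
    refine hx ?_
    have : b.rOut < ‖-x‖ := by simpa [b] using hx'
    simp only [k, gradCl_bump_eq_zero_of_lt b this, mul_zero]
  -- Translating the cutoff along with `y` writes `f` as a convolution of itself with a smooth
  -- compactly supported kernel.
  have hrep : f = fun y => (-(kerConst n)⁻¹) • (k ⋆[mulCl n, volume] f) y := by
    funext y
    have h := (hf.comp_add_right y).integral_cauchyKer (y := 0) (ψ := b) b.contDiff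
      b.hasCompactSupport (b.one_of_mem_closedBall (by simp [b.rIn_pos.le])) b.rIn_pos
      (fun x hx => gradCl_bump_eq_zero b (by simpa using hx))
    simp only [sub_zero, zero_add] at h
    have h2 : (k ⋆[mulCl n, volume] f) y = -(kerConst n • f y) := by
      rw [← h, ← integral_neg_eq_self]
      refine integral_congr_ae (Eventually.of_forall fun t => ?_)
      simp only [k, mulCl_apply, mul_assoc, sub_eq_neg_add]
    rw [h2, smul_neg, neg_smul, neg_neg, smul_smul, inv_mul_cancel₀ (kerConst_pos n).ne', one_smul]
  rw [hrep]
  exact (hksupp.contDiff_convolution_left (mulCl n) hk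
    hf.1.continuous.locallyIntegrable).const_smul _

end Cutoff

/-! ### Homogeneous parts as derivatives along lines. -/

section FueterExpansion

open scoped ContDiff

theorem contDiff_pderivCl {n : ℕ} {f : EuclideanSpace ℝ (Fin (n + 1)) → Cl n}
    (hf : ContDiff ℝ ∞ f) (j : Fin (n + 1)) : ContDiff ℝ ∞ (pderivCl j f) :=
  (hf.fderiv_right (m := ∞) (by simp)).clm_apply contDiff_const

theorem pderivCl_comm {n : ℕ} {f : EuclideanSpace ℝ (Fin (n + 1)) → Cl n}
    (hf : ContDiff ℝ ∞ f) (i j : Fin (n + 1)) :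
    pderivCl i (pderivCl j f) = pderivCl j (pderivCl i f) := by
  funext x
  have hd : DifferentiableAt ℝ (fderiv ℝ f) x :=
    (hf.fderiv_right (m := ∞) (by simp)).differentiable (by simp) x
  have h : ∀ k l, pderivCl k (pderivCl l f) x =
      fderiv ℝ (fderiv ℝ f) x (EuclideanSpace.single k 1) (EuclideanSpace.single l 1) := by
    intro k l
    change fderiv ℝ (fun y => fderiv ℝ f y (EuclideanSpace.single l 1)) x _ = _
    rw [fderiv_clm_apply hd (differentiableAt_const _)]
    simp
  rw [h, h]
  exact (hf.contDiffAt.isSymmSndFDerivAt (by simp; exact WithTop.coe_le_coe.mpr (le_top : (2 : ℕ∞) ≤ ⊤))) _ _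

theorem IsLeftMonogenic.pderivCl {n : ℕ} {f : EuclideanSpace ℝ (Fin (n + 1)) → Cl n}
    (hf : IsLeftMonogenic f) (j : Fin (n + 1)) : IsLeftMonogenic (pderivCl j f) := by
  have hs := hf.contDiff
  refine ⟨(contDiff_pderivCl hs j).of_le (by simp), fun x => ?_⟩
  rw [← diracCl_eq]
  have hzero : (fun x => ∑ k, coordUnit n k * _root_.pderivCl k f x) = fun _ => 0 :=
    funext hf.diracCl_eq_zero
  have h : ∀ k, HasFDerivAt (fun x => coordUnit n k * _root_.pderivCl k f x)
      ((mulCl n (coordUnit n k)).comp (fderiv ℝ (_root_.pderivCl k f) x)) x := fun k =>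
    (mulCl n (coordUnit n k)).hasFDerivAt.comp x
      ((contDiff_pderivCl hs k).differentiable (by simp) x).hasFDerivAt
  have h2 := (HasFDerivAt.fun_sum fun k (_ : k ∈ Finset.univ) => h k).fderiv
  rw [hzero] at h2
  have h3 := congrArg (fun L : EuclideanSpace ℝ (Fin (n + 1)) →L[ℝ] Cl n =>
    L (EuclideanSpace.single j 1)) h2
  simp only [fderiv_fun_const, Pi.zero_apply, _root_.zero_apply, _root_.sum_apply,
    ContinuousLinearMap.comp_apply, mulCl_apply] at h3
  rw [diracCl, h3]
  refine Finset.sum_congr rfl fun k _ => ?_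
  rw [pderivCl_comm hs k j]
  rfl

/-- Iterated partial derivatives along a word in the letters `1, …, n`. -/
noncomputable def wordDeriv {n : ℕ} (l : List (Fin n))
    (f : EuclideanSpace ℝ (Fin (n + 1)) → Cl n) : EuclideanSpace ℝ (Fin (n + 1)) → Cl n :=
  l.foldr (fun i g => pderivCl i.succ g) f

theorem IsLeftMonogenic.wordDeriv {n : ℕ} {f : EuclideanSpace ℝ (Fin (n + 1)) → Cl n}
    (hf : IsLeftMonogenic f) (l : List (Fin n)) : IsLeftMonogenic (wordDeriv l f) := by
  induction l with
  | nil => exact hf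
  | cons i l ih => exact ih.pderivCl i.succ

theorem IsLeftMonogenic.wordDeriv_perm {n : ℕ} {f : EuclideanSpace ℝ (Fin (n + 1)) → Cl n}
    (hf : IsLeftMonogenic f) {l l' : List (Fin n)} (h : l.Perm l') :
    _root_.wordDeriv l f = _root_.wordDeriv l' f := by
  induction h with
  | nil => rfl
  | cons i _ ih => exact congrArg (_root_.pderivCl i.succ) ih
  | swap i j l => exact pderivCl_comm (hf.wordDeriv l).contDiff _ _
  | trans _ _ ih₁ ih₂ => exact ih₁.trans ih₂

theorem multiDeriv_eq_wordDeriv {n : ℕ} (m : Fin n → ℕ)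
    (f : EuclideanSpace ℝ (Fin (n + 1)) → Cl n) :
    multiDeriv m f =
      wordDeriv ((List.finRange n).flatMap fun i => List.replicate (m i) i) f := by
  have hrep : ∀ (k : ℕ) (i : Fin n) (g : EuclideanSpace ℝ (Fin (n + 1)) → Cl n),
      (pderivCl i.succ)^[k] g = wordDeriv (List.replicate k i) g := by
    intro k i g
    induction k with
    | zero => rfl
    | succ k ih => rw [Function.iterate_succ_apply', ih]; rfl
  unfold multiDeriv
  induction List.finRange n with
  | nil => rfl
  | cons i l ih =>
    rw [List.foldr_cons, ih, hrep, List.flatMap_cons]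
    simp only [wordDeriv, List.foldr_append]

theorem count_ofFn_eq_card {n q : ℕ} (w : Fin q → Fin n) (i : Fin n) :
    (List.ofFn w).count i = (Finset.univ.filter fun j => w j = i).card := by
  rw [Finset.card_filter]
  induction q with
  | zero => simp
  | succ q ih =>
    rw [List.ofFn_succ, List.count_cons, ih, Fin.sum_univ_succ, add_comm]
    simp

theorem IsLeftMonogenic.wordDeriv_ofFn {n : ℕ} {f : EuclideanSpace ℝ (Fin (n + 1)) → Cl n}
    (hf : IsLeftMonogenic f) {q : ℕ} {w : Fin q → Fin n} {m : Fin n → ℕ}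
    (hw : ∀ i, (Finset.univ.filter fun j => w j = i).card = m i) :
    _root_.wordDeriv (List.ofFn w) f = multiDeriv m f := by
  rw [multiDeriv_eq_wordDeriv]
  refine hf.wordDeriv_perm (List.perm_iff_count.2 fun i => ?_)
  rw [count_ofFn_eq_card, hw, List.count_flatMap, ← List.ofFn_eq_map, List.sum_ofFn,
    Finset.sum_eq_single i]
  · simp
  · intro j _ hj
    simp [List.count_replicate, hj]
  · simp

theorem EuclideanSpace.eq_sum_single {n : ℕ} (y : EuclideanSpace ℝ (Fin (n + 1))) :
    y = ∑ j, y j • EuclideanSpace.single j (1 : ℝ) := by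
  ext k
  simp [Finset.sum_apply, Pi.single_apply]

/-- The Cauchy–Riemann equation eliminates `∂_{x_0}` from the directional derivative; the
coefficient left in front of `∂_{x_i}` is `y_i - y_0 e_i`. This is where the Fueter variables come
from. -/
theorem IsLeftMonogenic.hasDerivAt_line {n : ℕ} {f : EuclideanSpace ℝ (Fin (n + 1)) → Cl n}
    (hf : IsLeftMonogenic f) (y : EuclideanSpace ℝ (Fin (n + 1))) (s : ℝ) :
    HasDerivAt (fun s : ℝ => f (s • y))
      (∑ i, fueterVar i y * _root_.pderivCl i.succ f (s • y)) s := by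
  have h1 : HasDerivAt (fun s : ℝ => s • y) y s := by
    simpa using (hasDerivAt_id s).smul_const y
  have h2 := (hf.1.differentiable one_ne_zero (s • y)).hasFDerivAt.comp_hasDerivAt s h1
  refine h2.congr_deriv ?_
  have hy : fderiv ℝ f (s • y) y =
      fderiv ℝ f (s • y) (∑ j, y j • EuclideanSpace.single j (1 : ℝ)) :=
    congrArg _ (EuclideanSpace.eq_sum_single y)
  rw [hy, map_sum, Fin.sum_univ_succ]
  have h0 : fderiv ℝ f (s • y) (EuclideanSpace.single 0 1) =
      -∑ i : Fin n, imUnit n i * _root_.pderivCl i.succ f (s • y) :=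
    eq_neg_of_add_eq_zero_left (hf.2 (s • y))
  simp only [map_smul]
  rw [h0, smul_neg, Finset.smul_sum, ← Finset.sum_neg_distrib,
    ← Finset.sum_add_distrib]
  refine Finset.sum_congr rfl fun i _ => ?_
  rw [fueterVar, sub_mul, ← Algebra.smul_def, smul_mul_assoc, sub_eq_neg_add]
  rfl

/-- Word derivatives of `f` are again monogenic, so the first-order formula can be iterated. Each
new variable enters on the right of the product, whose factors do not commute; the derivatives do
commute, so the new letter can be moved to the end of the word. -/
theorem IsLeftMonogenic.iteratedDeriv_line {n : ℕ} {f : EuclideanSpace ℝ (Fin (n + 1)) → Cl n}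
    (hf : IsLeftMonogenic f) (y : EuclideanSpace ℝ (Fin (n + 1))) (q : ℕ) :
    iteratedDeriv q (fun s : ℝ => f (s • y)) = fun s => ∑ w : Fin q → Fin n,
      (List.ofFn fun j => fueterVar (w j) y).prod * _root_.wordDeriv (List.ofFn w) f (s • y) := by
  induction q with
  | zero => funext s; simp [_root_.wordDeriv]
  | succ q ih =>
    funext s
    rw [iteratedDeriv_succ, ih]
    have h : ∀ w : Fin q → Fin n, HasDerivAt (fun s : ℝ =>
        (List.ofFn fun j => fueterVar (w j) y).prod * _root_.wordDeriv (List.ofFn w) f (s • y))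
        ((List.ofFn fun j => fueterVar (w j) y).prod *
          ∑ i, fueterVar i y * _root_.pderivCl i.succ (_root_.wordDeriv (List.ofFn w) f) (s • y))
        s := fun w =>
      (mulCl n _).hasFDerivAt.comp_hasDerivAt s ((hf.wordDeriv (List.ofFn w)).hasDerivAt_line y s)
    rw [(HasDerivAt.fun_sum fun w _ => h w).deriv,
      ← (Fin.snocEquiv fun _ : Fin (q + 1) => Fin n).sum_comp, Fintype.sum_prod_type,
      Finset.sum_comm]
    refine Finset.sum_congr rfl fun w _ => ?_
    rw [Finset.mul_sum]
    refine Finset.sum_congr rfl fun i _ => ?_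
    have e1 : (List.ofFn fun j => fueterVar (Fin.snoc (α := fun _ => Fin n) w i j) y).prod =
        (List.ofFn fun j => fueterVar (w j) y).prod * fueterVar i y := by
      rw [List.ofFn_succ']
      simp [List.concat_eq_append]
    have e2 : _root_.wordDeriv (List.ofFn (Fin.snoc (α := fun _ => Fin n) w i)) f =
        _root_.pderivCl i.succ (_root_.wordDeriv (List.ofFn w) f) := by
      rw [List.ofFn_succ', List.concat_eq_append]
      simp only [Fin.snoc_castSucc, Fin.snoc_last]
      exact hf.wordDeriv_perm (List.perm_append_singleton i _)
    simp only [Fin.snocEquiv_apply]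
    rw [e1]
    change _ = _ * _root_.wordDeriv (List.ofFn (Fin.snoc (α := fun _ => Fin n) w i)) f (s • y)
    rw [e2, mul_assoc]

theorem fueterPoly_eq {n q : ℕ} {m : Fin n → ℕ} (hm : ∑ i, m i = q)
    (x : EuclideanSpace ℝ (Fin (n + 1))) :
    fueterPoly m x = (((∏ i, (m i).factorial : ℕ) : ℝ) / (q.factorial : ℝ)) •
      ∑ w : Fin q → Fin n with ∀ i, (Finset.univ.filter fun j => w j = i).card = m i,
        (List.ofFn fun j => fueterVar (w j) x).prod := by
  subst hm
  rfl

/-- The homogeneous parts are the Taylor coefficients along lines through the origin. -/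
theorem IsLeftMonogenic.homPart_eq {n : ℕ} {f : EuclideanSpace ℝ (Fin (n + 1)) → Cl n}
    (hf : IsLeftMonogenic f) (q : ℕ) (y : EuclideanSpace ℝ (Fin (n + 1))) :
    homPart f q y = ((q.factorial : ℝ))⁻¹ • iteratedDeriv q (fun s : ℝ => f (s • y)) 0 := by
  rw [hf.iteratedDeriv_line y q]
  have hmaps : ∀ w ∈ (Finset.univ : Finset (Fin q → Fin n)),
      (fun i => (Finset.univ.filter fun j => w j = i).card) ∈
        Finset.piAntidiag (Finset.univ : Finset (Fin n)) q := by
    intro w _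
    rw [Finset.mem_piAntidiag]
    refine ⟨?_, by simp⟩
    rw [← Finset.card_eq_sum_card_fiberwise (by simp)]
    simp
  simp only [zero_smul]
  -- Words are grouped by the number of occurrences of each letter; the word derivative is constant
  -- on a group.
  rw [← Finset.sum_fiberwise_of_maps_to hmaps, Finset.smul_sum, homPart]
  refine Finset.sum_congr rfl fun m hm => ?_
  rw [fueterPoly_eq (Finset.mem_piAntidiag.mp hm).1, taylorCoeff, smul_mul_smul_comm,
    Finset.sum_mul]
  have hfac : ((∏ i, (m i).factorial : ℕ) : ℝ) ≠ 0 := by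
    exact_mod_cast Finset.prod_ne_zero_iff.mpr fun i _ => (m i).factorial_ne_zero
  have hc : ((∏ i, (m i).factorial : ℕ) : ℝ) / (q.factorial : ℝ) *
      ((∏ i, (m i).factorial : ℕ) : ℝ)⁻¹ = (q.factorial : ℝ)⁻¹ := by
    field_simp
  rw [hc]
  congr 1
  refine Finset.sum_congr ?_ fun w hw => ?_
  · ext w
    simp [funext_iff]
  · rw [hf.wordDeriv_ofFn (m := m) (congrFun (Finset.mem_filter.mp hw).2)]

end FueterExpansion

/-! ### Power series of the Cauchy kernel along a line. -/

section KernelSeries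

open MeasureTheory

theorem HasSum.congr_terms {M : Type*} [AddCommMonoid M] [TopologicalSpace M] {f g : ℕ → M} {a : M}
    (h : HasSum f a) (hfg : ∀ q, f q = g q) : HasSum g a :=
  funext hfg ▸ h

theorem exists_binomial_series (e : ℝ) : ∃ b : ℕ → ℂ,
    ∀ z : ℂ, ‖z‖ < 1 → HasSum (fun j => b j * z ^ j) ((1 - z) ^ (e : ℂ)) := by
  have hd : DifferentiableOn ℂ (fun z : ℂ => (1 - z) ^ (e : ℂ)) (Metric.ball 0 1) := by
    intro z hz
    have hz' : ‖z‖ < 1 := by simpa using hz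
    have hslit : 1 - z ∈ Complex.slitPlane := by
      refine Or.inl ?_
      have := (Complex.re_le_norm z).trans_lt hz'
      simpa using this
    exact ((differentiableAt_id.const_sub 1).cpow_const hslit).differentiableWithinAt
  refine ⟨fun j => ((j.factorial : ℂ))⁻¹ *
    iteratedDeriv j (fun z : ℂ => (1 - z) ^ (e : ℂ)) 0, fun z hz => ?_⟩
  have h := Complex.hasSum_taylorSeries_on_ball hd (z := z) (by simpa using hz)
  refine h.congr_terms fun j => ?_
  simp only [sub_zero, smul_eq_mul]
  ring

theorem one_sub_cpow_mul_conj (e : ℝ) {z : ℂ} (hz : ‖z‖ < 1) :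
    (1 - z) ^ (e : ℂ) * (1 - (starRingEnd ℂ) z) ^ (e : ℂ) = (((‖1 - z‖ ^ 2) ^ e : ℝ) : ℂ) := by
  have hre : 0 < (1 - z).re := by
    have := (Complex.re_le_norm z).trans_lt hz
    simpa using this
  have harg : (1 - (starRingEnd ℂ) z).arg ≠ Real.pi := by
    refine Complex.slitPlane_arg_ne_pi (Or.inl ?_)
    simpa using hre
  have h := Complex.cpow_conj (1 - (starRingEnd ℂ) z) (e : ℂ) harg
  simp only [Complex.conj_ofReal, map_sub, map_one, Complex.conj_conj] at h
  rw [h, Complex.mul_conj, Complex.normSq_eq_norm_sq, Complex.norm_cpow_real, ← Real.rpow_natCast,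
    ← Real.rpow_natCast, ← Real.rpow_mul (norm_nonneg _), ← Real.rpow_mul (norm_nonneg _), mul_comm]

/-- The Gegenbauer expansion of `|1 - s α| ^ (2 e)` in powers of `s`. -/
theorem exists_gegenbauer_series (e : ℝ) : ∃ C : ℕ → ℂ → ℝ, (∀ q, Continuous (C q)) ∧
    (∀ t : ℝ, 0 < t → t < 1 → ∃ B : ℝ, 0 ≤ B ∧ ∀ q α, |C q α| ≤ B * (‖α‖ / t) ^ q) ∧
    ∀ (α : ℂ) (s : ℝ), |s| * ‖α‖ < 1 →
      HasSum (fun q => s ^ q * C q α) ((‖1 - s * α‖ ^ 2) ^ e) := by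
  obtain ⟨b, hb⟩ := exists_binomial_series e
  refine ⟨fun q α => (∑ kl ∈ Finset.HasAntidiagonal.antidiagonal q,
    (b kl.1 * α ^ kl.1) * (b kl.2 * (starRingEnd ℂ) α ^ kl.2)).re, ?_, ?_, ?_⟩
  · intro q
    refine Complex.continuous_re.comp (continuous_finsetSum _ fun kl _ => ?_)
    exact (continuous_const.mul (continuous_id.pow _)).mul
      (continuous_const.mul (Complex.continuous_conj.pow _))
  · intro t ht0 ht1
    -- Absolute convergence of the binomial series at `t` bounds each Cauchy-product coefficient by
    -- the square of its sum, with `t^(-q)` as the price.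
    have hs : Summable fun j => ‖b j‖ * t ^ j := by
      have := (hb t (by simpa [abs_of_pos ht0] using ht1)).summable.norm
      simpa [abs_of_pos ht0] using this
    have hnn : ∀ j, 0 ≤ ‖b j‖ * t ^ j := fun j => by positivity
    refine ⟨(∑' j, ‖b j‖ * t ^ j) ^ 2, sq_nonneg _, fun q α => ?_⟩
    have hterm : ∀ kl ∈ Finset.HasAntidiagonal.antidiagonal q,
        ‖(b kl.1 * α ^ kl.1) * (b kl.2 * (starRingEnd ℂ) α ^ kl.2)‖ =
          ((‖b kl.1‖ * t ^ kl.1) * (‖b kl.2‖ * t ^ kl.2)) * (‖α‖ / t) ^ q := by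
      intro kl hkl
      rw [← Finset.HasAntidiagonal.mem_antidiagonal.mp hkl, norm_mul, norm_mul, norm_mul, norm_pow, norm_pow,
        RCLike.norm_conj, div_pow, pow_add, pow_add]
      field_simp
    have hsub : Finset.HasAntidiagonal.antidiagonal q ⊆ Finset.range (q + 1) ×ˢ Finset.range (q + 1) := by
      intro kl hkl
      have := Finset.HasAntidiagonal.mem_antidiagonal.mp hkl
      simp only [Finset.mem_product, Finset.mem_range]
      omega
    calc _ ≤ ‖∑ kl ∈ Finset.HasAntidiagonal.antidiagonal q,
            (b kl.1 * α ^ kl.1) * (b kl.2 * (starRingEnd ℂ) α ^ kl.2)‖ := Complex.abs_re_le_norm _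
      _ ≤ ∑ kl ∈ Finset.HasAntidiagonal.antidiagonal q,
            ‖(b kl.1 * α ^ kl.1) * (b kl.2 * (starRingEnd ℂ) α ^ kl.2)‖ := norm_sum_le _ _
      _ = (∑ kl ∈ Finset.HasAntidiagonal.antidiagonal q, (‖b kl.1‖ * t ^ kl.1) * (‖b kl.2‖ * t ^ kl.2)) *
            (‖α‖ / t) ^ q := by
          rw [Finset.sum_congr rfl hterm, Finset.sum_mul]
      _ ≤ (∑' j, ‖b j‖ * t ^ j) ^ 2 * (‖α‖ / t) ^ q := by
          refine mul_le_mul_of_nonneg_right ?_ (by positivity)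
          refine (Finset.sum_le_sum_of_subset_of_nonneg hsub
            fun kl _ _ => mul_nonneg (hnn _) (hnn _)).trans ?_
          rw [Finset.sum_product]
          dsimp only
          rw [← Finset.sum_mul_sum, sq]
          have := hs.sum_le_tsum (Finset.range (q + 1)) fun j _ => hnn j
          exact mul_le_mul this this (Finset.sum_nonneg fun j _ => hnn j) (tsum_nonneg hnn)
  · intro α s hs
    have hn : ‖(s : ℂ) * α‖ < 1 := by simpa using hs
    have hn' : ‖(s : ℂ) * (starRingEnd ℂ) α‖ < 1 := by simpa using hs
    have h1 := hb _ hn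
    have h2 := hb _ hn'
    have hsum := (summable_norm_sum_mul_antidiagonal_of_summable_norm h1.summable.norm
      h2.summable.norm).of_norm.hasSum
    rw [← tsum_mul_tsum_eq_tsum_sum_antidiagonal_of_summable_norm h1.summable.norm
      h2.summable.norm, h1.tsum_eq, h2.tsum_eq] at hsum
    have hc : (s : ℂ) * (starRingEnd ℂ) α = (starRingEnd ℂ) (s * α) := by simp
    conv at hsum => enter [2]; rw [hc, one_sub_cpow_mul_conj e hn]
    have hre := Complex.hasSum_re hsum
    rw [Complex.ofReal_re] at hre
    refine hre.congr_terms fun q => ?_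
    rw [← Complex.re_ofReal_mul, Finset.mul_sum]
    congr 1
    refine Finset.sum_congr rfl fun kl hkl => ?_
    rw [← Finset.HasAntidiagonal.mem_antidiagonal.mp hkl]
    push_cast
    ring

/-- The root `α` with `‖x - s y‖ = ‖x‖ |1 - s α|`. -/
noncomputable def kerRoot {n : ℕ} (y x : EuclideanSpace ℝ (Fin (n + 1))) : ℂ :=
  ⟨inner ℝ x y / ‖x‖ ^ 2, √(‖x‖ ^ 2 * ‖y‖ ^ 2 - inner ℝ x y ^ 2) / ‖x‖ ^ 2⟩

theorem measurable_kerRoot {n : ℕ} (y : EuclideanSpace ℝ (Fin (n + 1))) :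
    Measurable (kerRoot y) := by
  have h : kerRoot y = fun x => ((inner ℝ x y / ‖x‖ ^ 2 : ℝ) : ℂ) +
      ((√(‖x‖ ^ 2 * ‖y‖ ^ 2 - inner ℝ x y ^ 2) / ‖x‖ ^ 2 : ℝ) : ℂ) * Complex.I := by
    funext x
    exact Complex.mk_eq_add_mul_I _ _
  rw [h]
  fun_prop

theorem sq_inner_le {n : ℕ} (x y : EuclideanSpace ℝ (Fin (n + 1))) :
    0 ≤ ‖x‖ ^ 2 * ‖y‖ ^ 2 - inner ℝ x y ^ 2 := by
  have h := abs_real_inner_le_norm x y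
  have := pow_le_pow_left₀ (abs_nonneg _) h 2
  rw [sq_abs, mul_pow] at this
  linarith

theorem norm_kerRoot {n : ℕ} (y : EuclideanSpace ℝ (Fin (n + 1)))
    {x : EuclideanSpace ℝ (Fin (n + 1))} (hx : 0 < ‖x‖) : ‖kerRoot y x‖ = ‖y‖ / ‖x‖ := by
  have h : ‖kerRoot y x‖ ^ 2 = (‖y‖ / ‖x‖) ^ 2 := by
    rw [← Complex.normSq_eq_norm_sq, Complex.normSq_apply, kerRoot]
    have := Real.mul_self_sqrt (sq_inner_le x y)
    field_simp
    linear_combination this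
  exact (pow_left_inj₀ (norm_nonneg _) (by positivity) two_ne_zero).mp h

theorem norm_sub_smul_sq {n : ℕ} (y : EuclideanSpace ℝ (Fin (n + 1)))
    {x : EuclideanSpace ℝ (Fin (n + 1))} (hx : 0 < ‖x‖) (s : ℝ) :
    ‖x - s • y‖ ^ 2 = ‖x‖ ^ 2 * ‖1 - s * kerRoot y x‖ ^ 2 := by
  have h := norm_kerRoot y hx
  have h2 : ‖kerRoot y x‖ ^ 2 = (kerRoot y x).re ^ 2 + (kerRoot y x).im ^ 2 := by
    rw [← Complex.normSq_eq_norm_sq, Complex.normSq_apply]; ring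
  have h3 : (kerRoot y x).re = inner ℝ x y / ‖x‖ ^ 2 := rfl
  rw [← Complex.normSq_eq_norm_sq, Complex.normSq_apply, norm_sub_sq_real, inner_smul_right,
    norm_smul, mul_pow, Real.norm_eq_abs, sq_abs]
  simp only [Complex.sub_re, Complex.one_re, Complex.re_ofReal_mul, Complex.sub_im,
    Complex.one_im, Complex.im_ofReal_mul]
  have h4 : (kerRoot y x).im ^ 2 = (‖y‖ / ‖x‖) ^ 2 - (inner ℝ x y / ‖x‖ ^ 2) ^ 2 := by
    rw [← h, h2, h3]; ring
  have h5 : (1 - s * (kerRoot y x).re) * (1 - s * (kerRoot y x).re) +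
      (0 - s * (kerRoot y x).im) * (0 - s * (kerRoot y x).im) =
      1 - 2 * s * (kerRoot y x).re + s ^ 2 * ((kerRoot y x).re ^ 2 + (kerRoot y x).im ^ 2) := by
    ring
  rw [h5, h4, h3]
  field_simp
  ring

/-- Expansion of the potentials `∫ ‖x - s y‖ ^ (2 e) F(x) dx` in powers of `s`. -/
theorem exists_potential_series {n : ℕ} {e : ℝ} (he : e ≤ 0) {t : ℝ} (ht0 : 0 < t) (ht1 : t < 1) :
    ∃ B : ℝ, 0 ≤ B ∧ ∀ (y : EuclideanSpace ℝ (Fin (n + 1))), ‖y‖ ≤ 1 →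
      ∀ F : EuclideanSpace ℝ (Fin (n + 1)) → Cl n, Integrable F → (∀ x, ‖x‖ < t → F x = 0) →
      ∃ A : ℕ → Cl n, (∀ q, ‖A q‖ ≤ B * ((t ^ 2)⁻¹) ^ q * ∫ x, ‖F x‖) ∧
        ∀ s : ℝ, |s| < t ^ 2 →
          HasSum (fun q => s ^ q • A q) (∫ x, (‖x - s • y‖ ^ 2) ^ e • F x) := by
  obtain ⟨C, hC, hbound, hsum⟩ := exists_gegenbauer_series e
  obtain ⟨B, hB, hCB⟩ := hbound t ht0 ht1
  refine ⟨(t ^ 2) ^ e * B, by positivity, fun y hy F hF hF0 => ?_⟩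
  have hmeas : ∀ q, AEStronglyMeasurable
      (fun x => ((‖x‖ ^ 2) ^ e * C q (kerRoot y x)) • F x) volume := by
    intro q
    have h1 : Measurable fun x : EuclideanSpace ℝ (Fin (n + 1)) => (‖x‖ ^ 2) ^ e := by
      fun_prop
    have h2 : Measurable fun x => (‖x‖ ^ 2) ^ e * C q (kerRoot y x) :=
      h1.mul ((hC q).measurable.comp (measurable_kerRoot y))
    exact h2.aestronglyMeasurable.smul hF.1
  have hpt : ∀ q x, ‖((‖x‖ ^ 2) ^ e * C q (kerRoot y x)) • F x‖ ≤
      (t ^ 2) ^ e * B * ((t ^ 2)⁻¹) ^ q * ‖F x‖ := by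
    intro q x
    by_cases hx : ‖x‖ < t
    · simp [hF0 x hx]
    · rw [not_lt] at hx
      have hx0 : 0 < ‖x‖ := ht0.trans_le hx
      rw [norm_smul, norm_mul, Real.norm_of_nonneg (by positivity), Real.norm_eq_abs, mul_assoc _ B]
      have h1 : (‖x‖ ^ 2) ^ e ≤ (t ^ 2) ^ e :=
        Real.rpow_le_rpow_of_nonpos (by positivity) (by gcongr) he
      -- The root has modulus `‖y‖/‖x‖ ≤ 1/t`, and the coefficient bound costs another factor `1/t`;
      -- hence the rate `t^(-2)`.
      have h2 : |C q (kerRoot y x)| ≤ B * ((t ^ 2)⁻¹) ^ q := by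
        refine (hCB q _).trans ?_
        rw [norm_kerRoot y hx0]
        gcongr
        rw [div_div, ← one_div]
        exact div_le_div₀ zero_le_one hy (by positivity) (by rw [sq]; gcongr)
      gcongr
  refine ⟨fun q => ∫ x, ((‖x‖ ^ 2) ^ e * C q (kerRoot y x)) • F x, fun q => ?_, fun s hs => ?_⟩
  · rw [← integral_const_mul]
    exact norm_integral_le_of_norm_le (hF.norm.const_mul _) (Eventually.of_forall (hpt q))
  · have hgeo : Summable fun q : ℕ => (|s| / t ^ 2) ^ q :=
      summable_geometric_of_lt_one (by positivity) ((div_lt_one (by positivity)).mpr hs)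
    have hbd : ∀ x, (fun q : ℕ => (t ^ 2) ^ e * B * ‖F x‖ * (|s| / t ^ 2) ^ q) =
        fun q => |s| ^ q * ((t ^ 2) ^ e * B * ((t ^ 2)⁻¹) ^ q * ‖F x‖) := by
      intro x
      funext q
      rw [div_eq_mul_inv, mul_pow]
      ring
    have key := hasSum_integral_of_dominated_convergence (μ := volume)
      (F := fun q x => s ^ q • (((‖x‖ ^ 2) ^ e * C q (kerRoot y x)) • F x))
      (f := fun x => (‖x - s • y‖ ^ 2) ^ e • F x)
      (fun q x => |s| ^ q * ((t ^ 2) ^ e * B * ((t ^ 2)⁻¹) ^ q * ‖F x‖))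
      (fun q => (hmeas q).fun_const_smul _) ?_ ?_ ?_ ?_
    · simpa only [integral_smul] using key
    · intro q
      refine Eventually.of_forall fun x => ?_
      rw [norm_smul, norm_pow, Real.norm_eq_abs]
      exact mul_le_mul_of_nonneg_left (hpt q x) (by positivity)
    · refine Eventually.of_forall fun x => ?_
      rw [← hbd x]
      exact hgeo.mul_left _
    · have : (fun x => ∑' q : ℕ, |s| ^ q * ((t ^ 2) ^ e * B * ((t ^ 2)⁻¹) ^ q * ‖F x‖)) =
          fun x => (t ^ 2) ^ e * B * ‖F x‖ * ∑' q : ℕ, (|s| / t ^ 2) ^ q := by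
        funext x
        rw [← hbd x, tsum_mul_left]
      rw [this]
      exact (hF.norm.const_mul _).mul_const _
    · refine Eventually.of_forall fun x => ?_
      by_cases hx : ‖x‖ < t
      · simp [hF0 x hx, hasSum_zero]
      · rw [not_lt] at hx
        have hx0 : 0 < ‖x‖ := ht0.trans_le hx
        have hlt : |s| * ‖kerRoot y x‖ < 1 := by
          rw [norm_kerRoot y hx0, mul_div_assoc', div_lt_one hx0]
          calc |s| * ‖y‖ ≤ |s| * 1 := by gcongr
            _ < t ^ 2 := by simpa using hs
            _ ≤ t := by nlinarith
            _ ≤ ‖x‖ := hx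
        have h := ((hsum (kerRoot y x) s hlt).mul_left ((‖x‖ ^ 2) ^ e)).smul_const (F x)
        rw [norm_sub_smul_sq y hx0, Real.mul_rpow (by positivity) (by positivity)]
        refine h.congr_terms fun q => ?_
        rw [smul_smul]
        congr 1
        ring

end KernelSeries

/-! ### Taylor expansion and Cauchy estimates. -/

section TaylorExpansion

open MeasureTheory
open scoped ContDiff

theorem iteratedDeriv_eq_of_hasSum {F : Type*} [NormedAddCommGroup F] [NormedSpace ℝ F]
    [CompleteSpace F] {g : ℝ → F} {a : ℕ → F} {r : ℝ} (hr : 0 < r)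
    (h : ∀ s : ℝ, |s| < r → HasSum (fun q => s ^ q • a q) (g s)) (q : ℕ) :
    iteratedDeriv q g 0 = (q.factorial : ℝ) • a q := by
  let p : FormalMultilinearSeries ℝ ℝ F := fun k => ContinuousMultilinearMap.mkPiRing ℝ (Fin k) (a k)
  have hp : HasFPowerSeriesAt g p 0 := by
    rw [hasFPowerSeriesAt_iff]
    filter_upwards [Metric.ball_mem_nhds (0 : ℝ) hr] with s hs
    have := h s (by simpa using hs)
    simpa [p, FormalMultilinearSeries.coeff] using this
  obtain ⟨R, hR⟩ := hp
  have := hR.factorial_smul 1 q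
  rw [iteratedDeriv_eq_iteratedFDeriv, ← this, Nat.cast_smul_eq_nsmul]
  simp [p]

/-- In the cutoff Cauchy formula at `s • y`, the numerator of the kernel is `x̄ - s ȳ`, so the
integral is one potential minus `s` times another, and each has a power series in `s`. The constant
`K` is independent of `f`, which allows rescaling afterwards. -/
theorem IsLeftMonogenic.exists_taylor_series (n : ℕ) {t : ℝ} (ht0 : 0 < t) (ht1 : t < 1) :
    ∃ K : ℝ, 0 ≤ K ∧ ∀ f : EuclideanSpace ℝ (Fin (n + 1)) → Cl n, IsLeftMonogenic f → ∀ M : ℝ,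
      (∀ x, ‖x‖ ≤ 1 → ‖f x‖ ≤ M) → ∀ y, ‖y‖ ≤ 1 → ∃ a : ℕ → Cl n,
        (∀ q, ‖a q‖ ≤ K * M * ((t ^ 2)⁻¹) ^ q) ∧
        ∀ s : ℝ, |s| < t ^ 2 → HasSum (fun q => s ^ q • a q) (f (s • y)) := by
  have hexp : kerExp n ≤ 0 := by
    rw [kerExp]
    have : (0 : ℝ) ≤ ((n : ℝ) + 1) / 2 := by positivity
    linarith
  obtain ⟨B, hB, hseries⟩ := exists_potential_series (n := n) hexp ht0 ht1
  -- The gradient of this cutoff lives on `t ≤ ‖x‖ ≤ 1`, so the integrals only see values of `f` on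
  -- the unit ball and stay away from 0.
  let b : ContDiffBump (0 : EuclideanSpace ℝ (Fin (n + 1))) := ⟨t, 1, ht0, ht1⟩
  have hbc : ContDiff ℝ 1 b := b.contDiff
  let G : EuclideanSpace ℝ (Fin (n + 1)) → ℝ := fun x =>
    ‖mulCl n‖ ^ 2 * ‖paraConj n‖ * ‖gradCl b x‖
  have hgc : Continuous (gradCl (n := n) b) := continuous_gradCl hbc
  have hgsupp : HasCompactSupport (gradCl (n := n) b) := by
    refine HasCompactSupport.of_support_subset_isCompact
      (isCompact_closedBall (0 : EuclideanSpace ℝ (Fin (n + 1))) 1) fun x hx => ?_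
    by_contra hx'
    exact hx (gradCl_bump_eq_zero_of_lt b (by simpa [b] using hx'))
  have hG : Integrable G := ((hgc.integrable_of_hasCompactSupport hgsupp).norm).const_mul _
  have hk := kerConst_pos n
  refine ⟨(kerConst n)⁻¹ * (B * ∫ x, G x) * 2,
    by have : 0 ≤ ∫ x, G x := integral_nonneg fun x => by positivity
       positivity, fun f hf M hM y hy => ?_⟩
  have hM0 : 0 ≤ M := (norm_nonneg _).trans (hM 0 (by simp))
  have hmulc : ∀ {u v : EuclideanSpace ℝ (Fin (n + 1)) → Cl n}, Continuous u → Continuous v →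
      Continuous fun x => u x * v x := fun hu hv => ((mulCl n).continuous.comp hu).clm_apply hv
  let F : EuclideanSpace ℝ (Fin (n + 1)) → Cl n := fun x => gradCl b x * f x
  have hFc : Continuous F := hmulc hgc hf.1.continuous
  have hFsupp : HasCompactSupport F := hgsupp.mul_right
  have hF0 : ∀ x, ‖x‖ < t → F x = 0 := fun x hx => by
    simp only [F, gradCl_bump_eq_zero b hx, zero_mul]
  have hbound : ∀ v x, ‖x‖ ≤ 1 → ‖v‖ ≤ 1 → ‖paraConj n v * F x‖ ≤ G x * M := by
    intro v x hx hv
    have h1 := (paraConj n).le_opNorm v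
    calc ‖paraConj n v * F x‖ ≤ ‖mulCl n‖ * ‖paraConj n v‖ * ‖F x‖ := norm_mul_le_Cl _ _
      _ ≤ ‖mulCl n‖ * (‖paraConj n‖ * 1) * (‖mulCl n‖ * ‖gradCl b x‖ * M) := by
          gcongr
          · exact h1.trans (by gcongr)
          · exact (norm_mul_le_Cl _ _).trans (by gcongr; exact hM x hx)
      _ = G x * M := by simp only [G]; ring
  have hFout : ∀ x, 1 < ‖x‖ → F x = 0 := fun x hx => by
    simp only [F, gradCl_bump_eq_zero_of_lt b (show b.rOut < ‖x‖ from hx), zero_mul]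
  have hint : ∀ {u : EuclideanSpace ℝ (Fin (n + 1)) → Cl n}, Continuous u →
      Integrable fun x => u x * F x := fun hu =>
    (hmulc hu hFc).integrable_of_hasCompactSupport hFsupp.mul_left
  have hI1 : Integrable fun x => paraConj n x * F x := hint (paraConj n).continuous
  have hI2 : Integrable fun x => paraConj n y * F x := hint continuous_const
  have hnorm : ∀ u : EuclideanSpace ℝ (Fin (n + 1)) → EuclideanSpace ℝ (Fin (n + 1)),
      (∀ x, ‖x‖ ≤ 1 → ‖u x‖ ≤ 1) → Integrable (fun x => paraConj n (u x) * F x) →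
      ∫ x, ‖paraConj n (u x) * F x‖ ≤ (∫ x, G x) * M := by
    intro u hu hi
    rw [← integral_mul_const]
    refine integral_mono hi.norm (hG.mul_const M) fun x => ?_
    by_cases hx : ‖x‖ ≤ 1
    · exact hbound _ x hx (hu x hx)
    · simp only [hFout x (not_le.mp hx), mul_zero, norm_zero]
      positivity
  obtain ⟨A₁, hA₁, hs₁⟩ := hseries y hy _ hI1 fun x hx => by rw [hF0 x hx, mul_zero]
  obtain ⟨A₂, hA₂, hs₂⟩ := hseries y hy _ hI2 fun x hx => by rw [hF0 x hx, mul_zero]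
  -- The factor `s` in front of the second potential shifts its coefficients by one; the new
  -- constant term is 0. The shifted bound survives because `t^(-2) ≥ 1`.
  let A₂' : ℕ → Cl n := fun q => Nat.casesOn q 0 A₂
  have hT1 : 1 ≤ (t ^ 2)⁻¹ := (one_le_inv₀ (by positivity)).mpr (by nlinarith)
  refine ⟨fun q => (kerConst n)⁻¹ • (A₂' q - A₁ q), fun q => ?_, fun s hs => ?_⟩
  · have e1 : ‖A₁ q‖ ≤ B * ((∫ x, G x) * M) * ((t ^ 2)⁻¹) ^ q := by
      refine (hA₁ q).trans ?_
      rw [mul_right_comm]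
      gcongr
      exact hnorm (fun x => x) (fun x hx => hx) hI1
    have e2 : ∀ q, ‖A₂ q‖ ≤ B * ((∫ x, G x) * M) * ((t ^ 2)⁻¹) ^ q := fun q => by
      refine (hA₂ q).trans ?_
      rw [mul_right_comm]
      gcongr
      exact hnorm (fun _ => y) (fun x hx => hy) hI2
    have hpos : 0 ≤ B * ((∫ x, G x) * M) := by
      have : 0 ≤ ∫ x, G x := integral_nonneg fun x => by positivity
      positivity
    have e3 : ‖A₂' q‖ ≤ B * ((∫ x, G x) * M) * ((t ^ 2)⁻¹) ^ q := by
      cases q with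
      | zero => simpa [A₂'] using hpos
      | succ q =>
        refine (e2 q).trans ?_
        gcongr
        omega
    rw [norm_smul, Real.norm_of_nonneg (by positivity)]
    calc _ ≤ (kerConst n)⁻¹ * (B * ((∫ x, G x) * M) * ((t ^ 2)⁻¹) ^ q +
          B * ((∫ x, G x) * M) * ((t ^ 2)⁻¹) ^ q) := by
          gcongr
          exact (norm_sub_le _ _).trans (add_le_add e3 e1)
      _ = _ := by ring
  · have hsy : ‖s • y‖ < t ^ 2 := by
      rw [norm_smul, Real.norm_eq_abs]
      nlinarith [abs_nonneg s, norm_nonneg y]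
    have hsy' : ‖s • y‖ < t := by nlinarith
    have hrep := hf.integral_cauchyKer (y := s • y) hbc b.hasCompactSupport
      (b.one_of_mem_closedBall (by simpa using hsy'.le)) (sub_pos.mpr hsy') (fun x hx => by
        refine gradCl_bump_eq_zero b ?_
        have := norm_le_norm_sub_add x (s • y)
        change ‖x‖ < t
        linarith)
    have hshift : HasSum (fun q => s ^ q • A₂' q)
        (s • ∫ x, (‖x - s • y‖ ^ 2) ^ kerExp n • (paraConj n y * F x)) := by
      have h := (hs₂ s hs).const_smul s
      have h' := HasSum.zero_add (f := fun q => s ^ q • A₂' q)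
        (h.congr_terms (g := fun q => s ^ (q + 1) • A₂' (q + 1)) fun q => by
          rw [smul_smul, ← pow_succ'])
      simpa [A₂'] using h'
    have hker : ∀ x, cauchyKer (x - s • y) * (gradCl b x * f x) =
        (‖x - s • y‖ ^ 2) ^ kerExp n • (paraConj n x * F x) -
          s • ((‖x - s • y‖ ^ 2) ^ kerExp n • (paraConj n y * F x)) := by
      intro x
      rw [cauchyKer, map_sub, map_smul, smul_mul_assoc, sub_mul, smul_sub, smul_mul_assoc,
        smul_comm s]
    have hwint : ∀ {u : EuclideanSpace ℝ (Fin (n + 1)) → Cl n},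
        Integrable (fun x => u x * F x) →
        Integrable fun x => (‖x - s • y‖ ^ 2) ^ kerExp n • (u x * F x) := by
      intro u hu
      have hm : Measurable fun x : EuclideanSpace ℝ (Fin (n + 1)) =>
          (‖x - s • y‖ ^ 2) ^ kerExp n := by fun_prop
      refine Integrable.mono' (hu.norm.const_mul (((t - ‖s • y‖) ^ 2) ^ kerExp n))
        (hm.aestronglyMeasurable.smul hu.1) (Eventually.of_forall fun x => ?_)
      by_cases hx : ‖x‖ < t
      · simp [hF0 x hx]
      · rw [norm_smul, Real.norm_of_nonneg (by positivity)]
        refine mul_le_mul_of_nonneg_right ?_ (norm_nonneg _)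
        have hpos := sub_pos.mpr hsy'
        refine Real.rpow_le_rpow_of_nonpos (by positivity) ?_ hexp
        have := norm_le_norm_sub_add x (s • y)
        have hle : t - ‖s • y‖ ≤ ‖x - s • y‖ := by linarith [not_lt.mp hx]
        gcongr
    have hI3 : Integrable fun x =>
        s • ((‖x - s • y‖ ^ 2) ^ kerExp n • (paraConj n y * F x)) := (hwint hI2).smul s
    rw [integral_congr_ae (Eventually.of_forall hker), integral_sub (hwint hI1) hI3,
      integral_smul] at hrep
    have hfin := (hshift.sub (hs₁ s hs)).const_smul (kerConst n)⁻¹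
    rw [← neg_sub, neg_eq_iff_eq_neg.mpr hrep, smul_smul, inv_mul_cancel₀ hk.ne',
      one_smul] at hfin
    exact hfin.congr_terms fun q => by
      rw [← smul_sub, smul_comm]

theorem IsLeftMonogenic.contDiff_line {n : ℕ} {f : EuclideanSpace ℝ (Fin (n + 1)) → Cl n}
    (hf : IsLeftMonogenic f) (y : EuclideanSpace ℝ (Fin (n + 1))) :
    ContDiff ℝ ∞ fun s : ℝ => f (s • y) :=
  hf.contDiff.comp (contDiff_id.smul contDiff_const)

theorem IsLeftMonogenic.comp_smul {n : ℕ} {f : EuclideanSpace ℝ (Fin (n + 1)) → Cl n}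
    (hf : IsLeftMonogenic f) (R : ℝ) : IsLeftMonogenic fun x => f (R • x) := by
  refine ⟨hf.1.comp (contDiff_const_smul R), fun x => ?_⟩
  have h := hf.2 (R • x)
  simp only [_root_.pderivCl, fderiv_comp_smul, _root_.smul_apply, mul_smul_comm] at h ⊢
  rw [← Finset.smul_sum, ← smul_add, h, smul_zero]

theorem IsLeftMonogenic.homPart_smul {n : ℕ} {f : EuclideanSpace ℝ (Fin (n + 1)) → Cl n}
    (hf : IsLeftMonogenic f) (q : ℕ) (R : ℝ) (y : EuclideanSpace ℝ (Fin (n + 1))) :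
    homPart f q (R • y) = R ^ q • homPart f q y := by
  have h := congrFun (iteratedDeriv_comp_const_smul (n := q)
    ((hf.contDiff_line y).of_le (by exact_mod_cast le_top)) R) 0
  simp only [mul_zero] at h
  rw [hf.homPart_eq, hf.homPart_eq, smul_comm, ← h]
  simp only [smul_smul, mul_comm R]

theorem IsLeftMonogenic.homPart_comp_smul {n : ℕ} {f : EuclideanSpace ℝ (Fin (n + 1)) → Cl n}
    (hf : IsLeftMonogenic f) (q : ℕ) (R : ℝ) (y : EuclideanSpace ℝ (Fin (n + 1))) :
    homPart (fun x => f (R • x)) q y = homPart f q (R • y) := by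
  rw [hf.homPart_eq, (hf.comp_smul R).homPart_eq]
  simp only [smul_comm R]

/-- Cauchy estimates for the homogeneous parts, with a loss that is as small as one wishes in the
exponential scale, and convergence of the Taylor expansion near `0`. -/
theorem IsLeftMonogenic.exists_homPart_bound (n : ℕ) {t : ℝ} (ht0 : 0 < t) (ht1 : t < 1) :
    ∃ K : ℝ, 0 ≤ K ∧ ∀ f : EuclideanSpace ℝ (Fin (n + 1)) → Cl n, IsLeftMonogenic f → ∀ M : ℝ,
      (∀ x, ‖x‖ ≤ 1 → ‖f x‖ ≤ M) → ∀ y, ‖y‖ ≤ 1 →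
        (∀ q, ‖homPart f q y‖ ≤ K * M * ((t ^ 2)⁻¹) ^ q) ∧
        ∀ s : ℝ, |s| < t ^ 2 → HasSum (fun q => s ^ q • homPart f q y) (f (s • y)) := by
  obtain ⟨K, hK, h⟩ := IsLeftMonogenic.exists_taylor_series n ht0 ht1
  refine ⟨K, hK, fun f hf M hM y hy => ?_⟩
  obtain ⟨a, ha, hs⟩ := h f hf M hM y hy
  have haq : a = fun q => homPart f q y := by
    funext q
    rw [hf.homPart_eq, iteratedDeriv_eq_of_hasSum (pow_pos ht0 2) hs q, smul_smul,
      inv_mul_cancel₀ (by exact_mod_cast q.factorial_ne_zero), one_smul]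
  subst haq
  exact ⟨ha, hs⟩

/-- The Taylor expansion of an entire left monogenic function. -/
theorem IsLeftMonogenic.hasSum_homPart {n : ℕ} {f : EuclideanSpace ℝ (Fin (n + 1)) → Cl n}
    (hf : IsLeftMonogenic f) (y : EuclideanSpace ℝ (Fin (n + 1))) :
    HasSum (fun q => homPart f q y) (f y) := by
  obtain ⟨K, -, h⟩ := IsLeftMonogenic.exists_homPart_bound n (t := 1 / 2) (by norm_num)
    (by norm_num)
  have hpos : 0 < ‖y‖ + 1 := by positivity
  -- With `t = 1/2` the series converges for `|s| < 1/4`. Shrinking `y` into the unit ball and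
  -- enlarging the argument of `f` by `8(‖y‖+1)` makes `s = 1/8` reach `y`.
  have hg := hf.comp_smul (8 * (‖y‖ + 1))
  obtain ⟨x₀, -, hx₀⟩ := (isCompact_closedBall (0 : EuclideanSpace ℝ (Fin (n + 1))) 1).exists_isMaxOn
    ⟨0, by simp⟩ hg.1.continuous.norm.continuousOn
  have hy : ‖(‖y‖ + 1)⁻¹ • y‖ ≤ 1 := by
    rw [norm_smul, Real.norm_of_nonneg (by positivity), ← div_eq_inv_mul, div_le_one hpos]
    linarith
  have hs := (h _ hg _ (fun x hx => hx₀ (by simpa using hx)) _ hy).2 (1 / 8)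
    (by rw [abs_of_pos] <;> norm_num)
  have hcancel : (1 / 8 : ℝ) • (8 * (‖y‖ + 1)) • (‖y‖ + 1)⁻¹ • y = y := by
    rw [smul_smul, smul_smul]
    rw [show (1 / 8 : ℝ) * (8 * (‖y‖ + 1)) * (‖y‖ + 1)⁻¹ = 1 by field_simp, one_smul]
  have hval : (8 * (‖y‖ + 1)) • (1 / 8 : ℝ) • (‖y‖ + 1)⁻¹ • y = y := by
    rw [smul_comm, hcancel]
  rw [hval] at hs
  refine hs.congr_terms fun q => ?_
  rw [hf.homPart_comp_smul, ← hf.homPart_smul, hcancel]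

/-- Rescaling to the unit ball turns `R` into a factor `R^q` by homogeneity; the unit-ball estimate
is used with `√t`, so that its loss `t^(-2q)` becomes `t^(-q)`. -/
theorem IsLeftMonogenic.exists_homPart_bound_ball (n : ℕ) {t : ℝ} (ht0 : 0 < t) (ht1 : t < 1) :
    ∃ K : ℝ, 0 ≤ K ∧ ∀ f : EuclideanSpace ℝ (Fin (n + 1)) → Cl n, IsLeftMonogenic f →
      ∀ R : ℝ, 0 < R → ∀ M : ℝ, (∀ x, ‖x‖ ≤ R → ‖f x‖ ≤ M) → ∀ q y, ‖y‖ ≤ 1 →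
        ‖homPart f q y‖ ≤ K * M * ((t * R)⁻¹) ^ q := by
  obtain ⟨K, hK, h⟩ := IsLeftMonogenic.exists_homPart_bound n (t := √t) (Real.sqrt_pos.mpr ht0)
    (by rw [Real.sqrt_lt' one_pos]; simpa using ht1)
  refine ⟨K, hK, fun f hf R hR M hM q y hy => ?_⟩
  have := (h _ (hf.comp_smul R) M (fun x hx => hM _ ?_) y hy).1 q
  · rw [Real.sq_sqrt ht0.le, hf.homPart_comp_smul, hf.homPart_smul, norm_smul, norm_pow,
      Real.norm_of_nonneg hR.le] at this
    rw [mul_inv, mul_pow, ← mul_assoc, inv_pow R, ← div_eq_mul_inv, le_div_iff₀ (by positivity),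
      mul_comm]
    exact this
  · rw [norm_smul, Real.norm_of_nonneg hR.le]
    exact mul_le_of_le_one_right hR.le hx

/-- Boundedness ensures that `supHomPart` is a genuine supremum and not the default value 0 of
`sSup`. -/
theorem IsLeftMonogenic.bddAbove_homPart {n : ℕ} {f : EuclideanSpace ℝ (Fin (n + 1)) → Cl n}
    (hf : IsLeftMonogenic f) (q : ℕ) :
    BddAbove ((fun x => ‖homPart f q x‖) '' Metric.closedBall 0 1) := by
  obtain ⟨K, -, h⟩ := IsLeftMonogenic.exists_homPart_bound n (t := 1 / 2) (by norm_num)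
    (by norm_num)
  obtain ⟨x₀, -, hx₀⟩ := (isCompact_closedBall (0 : EuclideanSpace ℝ (Fin (n + 1))) 1).exists_isMaxOn
    ⟨0, by simp⟩ hf.1.continuous.norm.continuousOn
  refine ⟨K * ‖f x₀‖ * (((1 / 2) ^ 2)⁻¹) ^ q, ?_⟩
  rintro _ ⟨y, hy, rfl⟩
  exact (h f hf _ (fun x hx => hx₀ (by simpa using hx)) y (by simpa using hy)).1 q

theorem supHomPart_nonneg {n : ℕ} (f : EuclideanSpace ℝ (Fin (n + 1)) → Cl n) (q : ℕ) :
    0 ≤ supHomPart f q :=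
  Real.sSup_nonneg fun _ ⟨_, _, hxy⟩ => hxy ▸ norm_nonneg _

theorem supHomPart_le {n : ℕ} {f : EuclideanSpace ℝ (Fin (n + 1)) → Cl n} {q : ℕ} {c : ℝ}
    (h : ∀ y, ‖y‖ ≤ 1 → ‖homPart f q y‖ ≤ c) : supHomPart f q ≤ c :=
  csSup_le ((Metric.nonempty_closedBall.mpr zero_le_one).image _)
    fun _ ⟨y, hy, hxy⟩ => hxy ▸ h y (by simpa using hy)

theorem IsLeftMonogenic.norm_homPart_le {n : ℕ} {f : EuclideanSpace ℝ (Fin (n + 1)) → Cl n}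
    (hf : IsLeftMonogenic f) (q : ℕ) (x : EuclideanSpace ℝ (Fin (n + 1))) :
    ‖homPart f q x‖ ≤ supHomPart f q * ‖x‖ ^ q := by
  have hle : ∀ y, ‖y‖ ≤ 1 → ‖homPart f q y‖ ≤ supHomPart f q := fun y hy =>
    le_csSup (hf.bddAbove_homPart q) ⟨y, by simpa using hy, rfl⟩
  by_cases hx : x = 0
  · subst hx
    rcases Nat.eq_zero_or_pos q with rfl | hq
    · simpa using hle 0 (by simp)
    · have := hf.homPart_smul q 0 (0 : EuclideanSpace ℝ (Fin (n + 1)))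
      rw [smul_zero, zero_pow hq.ne', zero_smul] at this
      simp [this, hq.ne']
  · have hx' : 0 < ‖x‖ := norm_pos_iff.mpr hx
    have h1 := hf.homPart_smul q ‖x‖ (‖x‖⁻¹ • x)
    rw [smul_smul, mul_inv_cancel₀ hx'.ne', one_smul] at h1
    rw [h1, norm_smul, norm_pow, norm_norm, mul_comm]
    gcongr
    refine hle _ ?_
    rw [norm_smul, norm_inv, norm_norm, inv_mul_cancel₀ hx'.ne']

end TaylorExpansion

/-! ### Increments of proximate orders and the inverse growth function. -/

section ProximateOrder

theorem IsProximateOrder.differentiableAt {p : ℝ → ℝ} {ρ : ℝ} (hp : IsProximateOrder p ρ) {r : ℝ}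
    (hr : 0 < r) : DifferentiableAt ℝ p r :=
  hp.differentiableOn.differentiableAt (Ici_mem_nhds hr)

/-- The logarithm of `r ^ p r` grows like `ρ log r`, in the sense of increments. -/
theorem IsProximateOrder.exists_log_increment_bounds {p : ℝ → ℝ} {ρ : ℝ}
    (hp : IsProximateOrder p ρ) {δ : ℝ} (hδ : 0 < δ) :
    ∃ s₀ : ℝ, 1 ≤ s₀ ∧ ∀ s r, s₀ ≤ s → s ≤ r →
      (ρ - δ) * (Real.log r - Real.log s) ≤ p r * Real.log r - p s * Real.log s ∧
      p r * Real.log r - p s * Real.log s ≤ (ρ + δ) * (Real.log r - Real.log s) := by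
  -- The derivative of `p r log r` with respect to `log r` is `p'(r) r log r + p r`, which tends to
  -- `ρ`; the increments then follow by monotonicity after adding `∓(ρ ∓ δ) log r`.
  have hlim := hp.tendsto_deriv.add hp.tendsto
  rw [zero_add] at hlim
  obtain ⟨s₁, hs₁⟩ := eventually_atTop.mp
    (hlim.eventually (Metric.ball_mem_nhds ρ hδ))
  have hpos : ∀ {r}, r ∈ Set.Ici (max s₁ 1) → 0 < r := fun hr =>
    one_pos.trans_le ((le_max_right _ _).trans hr)
  have hder : ∀ c : ℝ, ∀ r ∈ Set.Ici (max s₁ 1),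
      HasDerivAt (fun r => p r * Real.log r + c * Real.log r)
        ((deriv p r * r * Real.log r + p r + c) / r) r := by
    intro c r hr
    have hr0 := hpos hr
    have hl := Real.hasDerivAt_log hr0.ne'
    have h := ((hp.differentiableAt hr0).hasDerivAt.mul hl).add (hl.const_mul c)
    refine h.congr_deriv ?_
    field_simp
  have hclose : ∀ r ∈ Set.Ici (max s₁ 1), |deriv p r * r * Real.log r + p r - ρ| < δ :=
    fun r hr => by simpa [Real.dist_eq] using hs₁ r ((le_max_left _ _).trans hr)
  have hmono : MonotoneOn (fun r => p r * Real.log r + -(ρ - δ) * Real.log r)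
      (Set.Ici (max s₁ 1)) := by
    refine monotoneOn_of_deriv_nonneg (convex_Ici _)
      (fun r hr => (hder _ r hr).continuousAt.continuousWithinAt)
      (fun r hr => (hder _ r (interior_subset hr)).differentiableAt.differentiableWithinAt)
      fun r hr => ?_
    have hr' := interior_subset hr
    rw [(hder _ r hr').deriv]
    refine div_nonneg ?_ (hpos hr').le
    have := (abs_lt.mp (hclose r hr')).1
    linarith
  have hanti : AntitoneOn (fun r => p r * Real.log r + -(ρ + δ) * Real.log r)
      (Set.Ici (max s₁ 1)) := by
    refine antitoneOn_of_deriv_nonpos (convex_Ici _)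
      (fun r hr => (hder _ r hr).continuousAt.continuousWithinAt)
      (fun r hr => (hder _ r (interior_subset hr)).differentiableAt.differentiableWithinAt)
      fun r hr => ?_
    have hr' := interior_subset hr
    rw [(hder _ r hr').deriv]
    refine div_nonpos_of_nonpos_of_nonneg ?_ (hpos hr').le
    have := (abs_lt.mp (hclose r hr')).2
    linarith
  refine ⟨max s₁ 1, le_max_right _ _, fun s r hs hsr => ?_⟩
  have h1 := hmono (Set.mem_Ici.mpr hs) (Set.mem_Ici.mpr (hs.trans hsr)) hsr
  have h2 := hanti (Set.mem_Ici.mpr hs) (Set.mem_Ici.mpr (hs.trans hsr)) hsr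
  simp only at h1 h2
  constructor <;> linarith

theorem IsNormalization.growthInv_pos {p' p : ℝ → ℝ} {ρ : ℝ} (h : IsNormalization p' p ρ) {t : ℝ}
    (ht : 0 < t) : 0 < growthInv p' t :=
  Function.invFunOn_mem (show t ∈ (fun r : ℝ => r ^ p' r) '' Set.Ioi 0 by
    rw [h.image_eq]; exact ht)

theorem IsNormalization.growthInv_rpow {p' p : ℝ → ℝ} {ρ : ℝ} (h : IsNormalization p' p ρ) {t : ℝ}
    (ht : 0 < t) : growthInv p' t ^ p' (growthInv p' t) = t :=
  Function.invFunOn_eq (f := fun r : ℝ => r ^ p' r)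
    (show t ∈ (fun r : ℝ => r ^ p' r) '' Set.Ioi 0 by rw [h.image_eq]; exact ht)

theorem IsNormalization.log_growthInv {p' p : ℝ → ℝ} {ρ : ℝ} (h : IsNormalization p' p ρ) {t : ℝ}
    (ht : 0 < t) :
    p' (growthInv p' t) * Real.log (growthInv p' t) = Real.log t := by
  rw [← Real.log_rpow (h.growthInv_pos ht), h.growthInv_rpow ht]

theorem IsNormalization.tendsto_growthInv {p' p : ℝ → ℝ} {ρ : ℝ} (h : IsNormalization p' p ρ) :
    Tendsto (fun q : ℕ => growthInv p' q) atTop atTop := by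
  refine tendsto_atTop.mpr fun A => ?_
  have hA : (0 : ℝ) < max A 1 := one_pos.trans_le (le_max_right _ _)
  filter_upwards [tendsto_natCast_atTop_atTop.eventually_ge_atTop (max A 1 ^ p' (max A 1)),
    eventually_gt_atTop 0] with q hq hq0
  have hq0' : (0 : ℝ) < q := by exact_mod_cast hq0
  by_contra hlt
  have h1 := h.strictMonoOn (h.growthInv_pos hq0') hA
    ((not_le.mp hlt).trans_le (le_max_left _ _))
  simp only [h.growthInv_rpow hq0'] at h1
  linarith

/-- This is `log u ≤ u - 1` at `u = aσV/q`, with equality at `V = q/(aσ)`, the maximizer of `(q/a)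
log V - σV`. -/
theorem log_le_mul_sub {a σ q V : ℝ} (ha : 0 < a) (hσ : 0 < σ) (hq : 0 < q) (hV : 0 < V) :
    q / a * Real.log V ≤ σ * V - q / a * (1 + Real.log (a * σ) - Real.log q) := by
  have h := Real.log_le_sub_one_of_pos (show 0 < a * σ * V / q by positivity)
  rw [Real.log_div (by positivity) hq.ne', Real.log_mul (by positivity) hV.ne'] at h
  have h2 := mul_le_mul_of_nonneg_left h (show 0 ≤ q / a by positivity)
  have h3 : q / a * (a * σ * V / q - 1) = σ * V - q / a := by field_simp
  linarith

end ProximateOrder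

/-! ### The two growth estimates and the lemma. -/

section Growth

/-- A growth bound for `f` implies the bound for the homogeneous parts. -/
theorem eventually_homPart_growth_le {n : ℕ} {ρ : ℝ} (hρ : 0 < ρ) {p p' : ℝ → ℝ}
    (hp' : IsNormalization p' p ρ) {σ σ' : ℝ} (hσ : 0 < σ) (hσ' : σ < σ')
    {f : EuclideanSpace ℝ (Fin (n + 1)) → Cl n} (hf : f ∈ growthSpace n p σ) :
    ∀ᶠ q : ℕ in atTop, (supHomPart f q * growthCoeff p' ρ q) ^ (ρ / (q : ℝ)) ≤ σ' := by
  obtain ⟨hmono, C, hC⟩ := hf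
  obtain ⟨r₁, hr₁, hpp⟩ := hp'.eventually_eq
  have hfle : ∀ x, ‖f x‖ ≤ C * Real.exp (σ * ‖x‖ ^ p ‖x‖) := by
    intro x
    have := hC ⟨x, rfl⟩
    simp only [neg_mul, Real.exp_neg] at this
    rwa [← div_eq_mul_inv, div_le_iff₀ (Real.exp_pos _)] at this
  obtain ⟨x₀, -, hx₀⟩ := (isCompact_closedBall (0 : EuclideanSpace ℝ (Fin (n + 1)))
    r₁).exists_isMaxOn ⟨0, by simp [hr₁.le]⟩ hmono.1.continuous.norm.continuousOn
  have hC0 : 0 ≤ C := by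
    have := (norm_nonneg _).trans (hfle 0)
    exact nonneg_of_mul_nonneg_left this (Real.exp_pos _)
  -- `p` and `p'` agree only from `r₁` on: there monotonicity of `r ^ p' r` applies, and the
  -- remaining ball is covered by compactness.
  have hball : ∀ R, r₁ ≤ R → ∀ x, ‖x‖ ≤ R →
      ‖f x‖ ≤ (C + ‖f x₀‖) * Real.exp (σ * R ^ p' R) := by
    intro R hR x hx
    have hR0 : 0 < R := hr₁.trans_le hR
    have hnn : 0 ≤ σ * R ^ p' R := by positivity
    by_cases hxr : r₁ ≤ ‖x‖
    · have hV : ‖x‖ ^ p ‖x‖ ≤ R ^ p' R := by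
        rw [← hpp _ hxr]
        exact hp'.strictMonoOn.monotoneOn (hr₁.trans_le hxr) hR0 hx
      refine (hfle x).trans ?_
      gcongr
      linarith [norm_nonneg (f x₀)]
    · have h1 : ‖f x‖ ≤ ‖f x₀‖ := hx₀ (by simpa using (not_le.mp hxr).le)
      have h2 : 1 ≤ Real.exp (σ * R ^ p' R) := Real.one_le_exp hnn
      nlinarith [norm_nonneg (f x₀)]
  -- The gap between `log σ` and `log σ'` is split in three: one `d` for the constant `D`, one for
  -- the Cauchy estimate loss, one for the deviation of the proximate order.
  obtain ⟨d, hd, hdσ⟩ : ∃ d : ℝ, 0 < d ∧ 3 * d + Real.log σ = Real.log σ' :=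
    ⟨(Real.log σ' - Real.log σ) / 3, by
      have := Real.log_lt_log hσ hσ'
      linarith, by ring⟩
  -- The radius is `R = e^(-l) φ(q) = φ(q) (ρσ)^(-1/ρ)`, for which `σ R^p'(R)` is asymptotically
  -- `q/ρ`.
  set l : ℝ := Real.log (ρ * σ) / ρ with hl
  have hd' : 0 < Real.log (1 + d) := Real.log_pos (by linarith)
  -- Between `φ(q)` and `R` the logarithm changes by `|l|`, so this slope error costs at most `log
  -- (1 + d)`; the `+ 1` covers `l = 0`.
  obtain ⟨s₀, hs₀, hinc⟩ := hp'.isProximateOrder.exists_log_increment_bounds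
    (δ := Real.log (1 + d) / (|l| + 1)) (by positivity)
  obtain ⟨K, hK, hbound⟩ := IsLeftMonogenic.exists_homPart_bound_ball n (t := Real.exp (-(d / ρ)))
    (Real.exp_pos _) (by rw [Real.exp_lt_one_iff]; have : 0 < d / ρ := by positivity
                         linarith)
  set D : ℝ := K * (C + ‖f x₀‖) + 1 with hD
  have hD0 : 0 < D := by positivity
  have hDlim : Tendsto (fun q : ℕ => D ^ (ρ / (q : ℝ))) atTop (𝓝 1) := by
    have h := (tendsto_const_div_atTop_nhds_zero_nat ρ)
    simpa using (tendsto_const_nhds (x := D)).rpow h (Or.inl hD0.ne')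
  have hR : Tendsto (fun q : ℕ => Real.exp (-l) * growthInv p' q) atTop atTop :=
    hp'.tendsto_growthInv.const_mul_atTop (Real.exp_pos _)
  filter_upwards [hDlim.eventually_lt_const (show 1 < Real.exp d by rwa [Real.one_lt_exp_iff]),
    hR.eventually_ge_atTop (max s₀ r₁), hp'.tendsto_growthInv.eventually_ge_atTop s₀,
    eventually_gt_atTop 0] with q hDq hRq hφq hq
  have hq0 : (0 : ℝ) < q := by exact_mod_cast hq
  have hφ := hp'.growthInv_pos hq0
  have hlogq := hp'.log_growthInv hq0
  set φ := growthInv p' q with hφdef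
  set R := Real.exp (-l) * φ with hRdef
  have hR0 : 0 < R := by positivity
  have hlogR : Real.log R = -l + Real.log φ := by
    rw [hRdef, Real.log_mul (Real.exp_pos _).ne' hφ.ne', Real.log_exp]
  have hVR : p' R * Real.log R ≤ Real.log q - ρ * l + Real.log (1 + d) := by
    have hle : Real.log (1 + d) / (|l| + 1) * |l| ≤ Real.log (1 + d) := by
      rw [div_mul_eq_mul_div, div_le_iff₀ (by positivity)]
      nlinarith [abs_nonneg l]
    rcases le_total φ R with hφR | hφR
    · have h := (hinc φ R hφq hφR).2
      have hle0 := Real.log_le_log hφ hφR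
      rw [hlogR] at hle0
      rw [hlogq] at h
      have habs : |l| = -l := abs_of_nonpos (by linarith)
      rw [habs] at hle h
      have : Real.log R - Real.log φ = -l := by rw [hlogR]; ring
      rw [this, add_mul] at h
      linarith
    · have h := (hinc R φ ((le_max_left _ _).trans hRq) hφR).1
      have hle0 := Real.log_le_log hR0 hφR
      rw [hlogR] at hle0
      rw [hlogq] at h
      have habs : |l| = l := abs_of_nonneg (by linarith)
      have : Real.log φ - Real.log R = l := by rw [hlogR]; ring
      rw [this, sub_mul] at h
      rw [habs] at hle h
      linarith
  have hVle : σ * R ^ p' R ≤ (1 + d) * q / ρ := by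
    have h1 : R ^ p' R ≤ q * (1 + d) / (ρ * σ) := by
      rw [← Real.log_le_log_iff (by positivity) (by positivity), Real.log_rpow hR0,
        Real.log_div (by positivity) (by positivity), Real.log_mul hq0.ne' (by positivity)]
      have : ρ * l = Real.log (ρ * σ) := by rw [hl]; field_simp
      linarith
    calc σ * R ^ p' R ≤ σ * (q * (1 + d) / (ρ * σ)) := by gcongr
      _ = _ := by field_simp
  have hKq : supHomPart f q ≤ K * ((C + ‖f x₀‖) * Real.exp (σ * R ^ p' R)) *
      ((Real.exp (-(d / ρ)) * R)⁻¹) ^ q :=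
    supHomPart_le fun y hy => hbound f hmono R hR0 _
      (hball R ((le_max_right _ _).trans hRq)) q y hy
  have hKG : supHomPart f q * growthCoeff p' ρ q ≤
      D * Real.exp ((2 * d + Real.log σ) * (q / ρ)) := by
    have hG : growthCoeff p' ρ q = φ ^ q * Real.exp (-((1 + Real.log ρ) * (q / ρ))) := by
      rw [growthCoeff, Real.rpow_def_of_pos (by positivity),
        Real.log_mul (Real.exp_pos _).ne' hρ.ne', Real.log_exp, Real.exp_neg, div_eq_mul_inv]
    have hinv : ((Real.exp (-(d / ρ)) * R)⁻¹) ^ q * φ ^ q = Real.exp ((d / ρ + l) * q) := by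
      rw [← mul_pow, hRdef, ← mul_assoc, ← Real.exp_add, mul_inv, inv_mul_cancel_right₀ hφ.ne',
        ← Real.exp_neg, ← Real.exp_nat_mul]
      congr 1
      ring
    rw [hG]
    calc _ ≤ K * ((C + ‖f x₀‖) * Real.exp ((1 + d) * q / ρ)) *
          ((Real.exp (-(d / ρ)) * R)⁻¹) ^ q *
          (φ ^ q * Real.exp (-((1 + Real.log ρ) * (q / ρ)))) := by
          gcongr
          exact hKq.trans (by gcongr)
      _ = K * (C + ‖f x₀‖) * (Real.exp ((1 + d) * q / ρ) * Real.exp ((d / ρ + l) * q) *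
          Real.exp (-((1 + Real.log ρ) * (q / ρ)))) := by rw [← hinv]; ring
      _ = K * (C + ‖f x₀‖) * Real.exp ((2 * d + Real.log σ) * (q / ρ)) := by
          rw [← Real.exp_add, ← Real.exp_add]
          congr 2
          rw [hl, Real.log_mul hρ.ne' hσ.ne']
          field_simp
          ring
      _ ≤ _ := by gcongr; rw [hD]; linarith
  have hG0 : 0 ≤ growthCoeff p' ρ q := by
    rw [growthCoeff]; positivity
  calc (supHomPart f q * growthCoeff p' ρ q) ^ (ρ / (q : ℝ))
      ≤ (D * Real.exp ((2 * d + Real.log σ) * (q / ρ))) ^ (ρ / (q : ℝ)) :=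
        Real.rpow_le_rpow (mul_nonneg (supHomPart_nonneg f q) hG0) hKG (by positivity)
    _ = D ^ (ρ / (q : ℝ)) * Real.exp (2 * d + Real.log σ) := by
        rw [Real.mul_rpow hD0.le (Real.exp_pos _).le, ← Real.exp_mul]
        congr 2
        field_simp
    _ ≤ Real.exp d * Real.exp (2 * d + Real.log σ) := by gcongr
    _ = σ' := by
        rw [← Real.exp_add, show d + (2 * d + Real.log σ) = Real.log σ' by linarith,
          Real.exp_log (hσ.trans hσ')]

/-- A bound for the homogeneous parts implies the growth bound for `f`. -/
theorem mem_growthSpace_of_eventually {n : ℕ} {ρ : ℝ} (hρ : 0 < ρ) {p p' : ℝ → ℝ}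
    (hp' : IsNormalization p' p ρ) {σ σ' : ℝ} (hσ : 0 < σ) (hσ' : σ < σ')
    {f : EuclideanSpace ℝ (Fin (n + 1)) → Cl n} (hf : IsLeftMonogenic f)
    (h : ∀ᶠ q : ℕ in atTop, (supHomPart f q * growthCoeff p' ρ q) ^ (ρ / (q : ℝ)) ≤ σ) :
    f ∈ growthSpace n p σ' := by
  have hσ'0 : 0 < σ' := hσ.trans hσ'
  obtain ⟨r₁, hr₁, hpp⟩ := hp'.eventually_eq
  -- The bound `log_le_mul_sub` with `a = ρ ± δ` replaces `(1 + log (ρσ'))/ρ` by its value at `a`;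
  -- by continuity a small `δ` keeps both values above a number `c` that still exceeds `(1 + log
  -- (ρσ))/ρ`. The surplus `η` yields the geometric factor `e^(-ηq)`.
  have hcont : ContinuousAt (fun a : ℝ => (1 + Real.log (a * σ')) / a) ρ := by
    refine ContinuousAt.div (continuousAt_const.add ?_) continuousAt_id hρ.ne'
    exact (continuousAt_id.mul continuousAt_const).log (by simp [hρ.ne', hσ'0.ne'])
  have hgap : (1 + Real.log (ρ * σ)) / ρ < (1 + Real.log (ρ * σ')) / ρ := by
    gcongr
  obtain ⟨c, hc1, hc2⟩ := exists_between hgap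
  obtain ⟨δ₀, hδ₀, hδ⟩ := Metric.eventually_nhds_iff.mp (hcont.eventually (lt_mem_nhds hc2))
  set δ := min (δ₀ / 2) (ρ / 2) with hδdef
  have hδpos : 0 < δ := by positivity
  have hδ1 : δ < δ₀ := (min_le_left _ _).trans_lt (by linarith)
  have hδ2 : δ < ρ := (min_le_right _ _).trans_lt (by linarith)
  have hm : c < (1 + Real.log ((ρ - δ) * σ')) / (ρ - δ) :=
    hδ (by rw [Real.dist_eq, sub_sub_cancel_left, abs_neg, abs_of_pos hδpos]; exact hδ1)
  have hM : c < (1 + Real.log ((ρ + δ) * σ')) / (ρ + δ) :=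
    hδ (by rw [Real.dist_eq, add_sub_cancel_left, abs_of_pos hδpos]; exact hδ1)
  have ham : 0 < ρ - δ := by linarith
  have haM : 0 < ρ + δ := by linarith
  obtain ⟨s₁, hs₁, hinc⟩ := hp'.isProximateOrder.exists_log_increment_bounds hδpos
  set s₀ := max s₁ r₁ with hs₀def
  have hs₀ : 0 < s₀ := hr₁.trans_le (le_max_right _ _)
  set η := c - (1 + Real.log (ρ * σ)) / ρ with hη
  have hηpos : 0 < η := sub_pos.mpr hc1
  have hKnn := supHomPart_nonneg f
  have hlarge : ∀ᶠ q : ℕ in atTop, ∀ r, s₀ ≤ r →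
      supHomPart f q * r ^ q ≤ Real.exp (-η) ^ q * Real.exp (σ' * r ^ p' r) := by
    filter_upwards [h, hp'.tendsto_growthInv.eventually_ge_atTop s₀, eventually_gt_atTop 0]
      with q hq hφq hqpos r hr
    have hq0 : (0 : ℝ) < q := by exact_mod_cast hqpos
    have hr0 : 0 < r := hs₀.trans_le hr
    have hφ := hp'.growthInv_pos hq0
    have hlogq := hp'.log_growthInv hq0
    have hG : growthCoeff p' ρ q =
        Real.exp (q * Real.log (growthInv p' q) - (1 + Real.log ρ) * (q / ρ)) := by
      rw [growthCoeff, Real.rpow_def_of_pos (by positivity),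
        Real.log_mul (Real.exp_pos _).ne' hρ.ne', Real.log_exp, Real.exp_sub, Real.exp_nat_mul,
        Real.exp_log hφ]
    set φ := growthInv p' q with hφdef
    have hKG : supHomPart f q * growthCoeff p' ρ q ≤ Real.exp (Real.log σ * (q / ρ)) := by
      have hnn : 0 ≤ supHomPart f q * growthCoeff p' ρ q :=
        mul_nonneg (hKnn q) (by rw [hG]; positivity)
      have h1 := Real.rpow_le_rpow (Real.rpow_nonneg hnn _) hq
        (show 0 ≤ (q : ℝ) / ρ by positivity)
      rw [← Real.rpow_mul hnn, show ρ / (q : ℝ) * (q / ρ) = 1 by field_simp, Real.rpow_one,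
        Real.rpow_def_of_pos hσ] at h1
      exact h1
    have hKq : supHomPart f q ≤ Real.exp (Real.log σ * (q / ρ) -
        (q * Real.log φ - (1 + Real.log ρ) * (q / ρ))) := by
      rw [Real.exp_sub, le_div_iff₀ (Real.exp_pos _), ← hG]
      exact hKG
    have hV0 : 0 < r ^ p' r := by positivity
    have hlogV : Real.log (r ^ p' r) = p' r * Real.log r := Real.log_rpow hr0 _
    -- The slope is taken as `ρ - δ` when `r ≥ φ(q)` and as `ρ + δ` when `r ≤ φ(q)`; in both cases
    -- `r/φ(q)` is controlled by the `a`-th root of `r^p'(r)/q`.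
    have key : ∀ a, 0 < a → c < (1 + Real.log (a * σ')) / a →
        a * (Real.log r - Real.log φ) ≤ Real.log (r ^ p' r) - Real.log q →
        q * (Real.log r - Real.log φ) ≤ σ' * r ^ p' r - q * c := by
      intro a ha hca hle
      have h1 := log_le_mul_sub ha hσ'0 hq0 hV0
      have h2 := mul_le_mul_of_nonneg_left hle (show 0 ≤ (q : ℝ) / a by positivity)
      have h3 : (q : ℝ) / a * (a * (Real.log r - Real.log φ)) =
          q * (Real.log r - Real.log φ) := by field_simp
      have h4 : (q : ℝ) * c ≤ q * ((1 + Real.log (a * σ')) / a) := by gcongr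
      have h5 : (q : ℝ) * ((1 + Real.log (a * σ')) / a) = q / a * (1 + Real.log (a * σ')) := by
        ring
      rw [h3] at h2
      linarith
    have hmain : q * (Real.log r - Real.log φ) ≤ σ' * r ^ p' r - q * c := by
      rcases le_total φ r with hle | hle
      · refine key _ ham hm ?_
        have := (hinc φ r ((le_max_left _ _).trans hφq) hle).1
        rw [hlogq] at this
        rwa [hlogV]
      · refine key _ haM hM ?_
        have := (hinc r φ ((le_max_left _ _).trans hr) hle).2
        rw [hlogq] at this
        rw [hlogV]
        linarith
    have hrq : r ^ q = Real.exp (q * Real.log r) := by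
      rw [Real.exp_nat_mul, Real.exp_log hr0]
    calc supHomPart f q * r ^ q ≤ Real.exp (Real.log σ * (q / ρ) -
          (q * Real.log φ - (1 + Real.log ρ) * (q / ρ))) * r ^ q := by gcongr
      _ ≤ Real.exp (-η) ^ q * Real.exp (σ' * r ^ p' r) := by
          rw [hrq, ← Real.exp_add, ← Real.exp_nat_mul, ← Real.exp_add, Real.exp_le_exp, hη,
            Real.log_mul hρ.ne' hσ.ne']
          have : (q : ℝ) * ((1 + (Real.log ρ + Real.log σ)) / ρ) =
            Real.log σ * (q / ρ) + (1 + Real.log ρ) * (q / ρ) := by ring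
          linarith
  -- The finitely many remaining terms only need some constant, since `exp (σ' r^p'(r))` dominates
  -- every power of `r`. For `q > 0` the witness collects what `log_le_mul_sub` and the increment
  -- from `s₀`, both with `a = ρ - δ`, leave independent of `r`.
  have hsmall : ∀ q : ℕ, ∃ c, ∀ r, s₀ ≤ r →
      supHomPart f q * r ^ q ≤ c * Real.exp (σ' * r ^ p' r) := by
    intro q
    rcases Nat.eq_zero_or_pos q with rfl | hq
    · refine ⟨supHomPart f 0, fun r hr => ?_⟩
      have hr0 : 0 < r := hs₀.trans_le hr
      rw [pow_zero]
      gcongr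
      · exact hKnn 0
      · exact Real.one_le_exp (by positivity)
    · have hq0 : (0 : ℝ) < q := by exact_mod_cast hq
      refine ⟨supHomPart f q * Real.exp (q * Real.log s₀ - q / (ρ - δ) * (p' s₀ * Real.log s₀) -
        q / (ρ - δ) * (1 + Real.log ((ρ - δ) * σ') - Real.log q)), fun r hr => ?_⟩
      have hr0 : 0 < r := hs₀.trans_le hr
      have h1 := (hinc s₀ r (le_max_left _ _) hr).1
      have h2 := log_le_mul_sub ham hσ'0 hq0 (show 0 < r ^ p' r by positivity)
      rw [Real.log_rpow hr0] at h2
      have h3 := mul_le_mul_of_nonneg_left h1 (show 0 ≤ (q : ℝ) / (ρ - δ) by positivity)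
      have h4 : (q : ℝ) / (ρ - δ) * ((ρ - δ) * (Real.log r - Real.log s₀)) =
          q * (Real.log r - Real.log s₀) := by field_simp
      rw [mul_assoc, ← Real.exp_add, show r ^ q = Real.exp (q * Real.log r) by
        rw [Real.exp_nat_mul, Real.exp_log hr0]]
      refine mul_le_mul_of_nonneg_left (Real.exp_le_exp.mpr ?_) (hKnn q)
      rw [h4] at h3
      linarith
  choose c' hc' using hsmall
  obtain ⟨N, hN⟩ := eventually_atTop.mp hlarge
  let b : ℕ → ℝ := fun q => if q < N then c' q else Real.exp (-η) ^ q
  have hb : ∀ q r, s₀ ≤ r → supHomPart f q * r ^ q ≤ b q * Real.exp (σ' * r ^ p' r) := by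
    intro q r hr
    by_cases hqN : q < N
    · simpa only [b, if_pos hqN] using hc' q r hr
    · simpa only [b, if_neg hqN] using hN q (not_lt.mp hqN) r hr
  have hbsum : Summable b := by
    rw [← summable_nat_add_iff N]
    have hgeo : Summable fun q : ℕ => Real.exp (-η) ^ q :=
      summable_geometric_of_lt_one (Real.exp_pos _).le (by rw [Real.exp_lt_one_iff]; linarith)
    refine ((summable_nat_add_iff N).mpr hgeo).congr fun q => ?_
    simp [b]
  obtain ⟨x₀, -, hx₀⟩ := (isCompact_closedBall (0 : EuclideanSpace ℝ (Fin (n + 1)))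
    s₀).exists_isMaxOn ⟨0, by simp [hs₀.le]⟩ hf.1.continuous.norm.continuousOn
  refine ⟨hf, max (∑' q, b q) ‖f x₀‖, ?_⟩
  rintro _ ⟨x, rfl⟩
  simp only
  by_cases hx : s₀ ≤ ‖x‖
  · refine le_trans ?_ (le_max_left _ _)
    rw [neg_mul, Real.exp_neg, ← div_eq_mul_inv, div_le_iff₀ (Real.exp_pos _),
      ← hpp _ ((le_max_right _ _).trans hx)]
    refine (hf.hasSum_homPart x).norm_le_of_bounded
      (hbsum.hasSum.mul_right (Real.exp (σ' * ‖x‖ ^ p' ‖x‖))) fun q => ?_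
    exact (hf.norm_homPart_le q x).trans (hb q _ hx)
  · refine le_trans ?_ (le_max_right _ _)
    have h1 : ‖f x‖ ≤ ‖f x₀‖ := hx₀ (by simpa using (not_le.mp hx).le)
    have h2 : Real.exp (-σ' * ‖x‖ ^ p ‖x‖) ≤ 1 := by
      rw [Real.exp_le_one_iff, neg_mul]
      have : 0 ≤ σ' * ‖x‖ ^ p ‖x‖ := by positivity
      linarith
    calc _ ≤ ‖f x₀‖ * 1 := by gcongr
      _ = _ := mul_one _

end Growth

/-- Each growth estimate loses an arbitrarily small amount of type, absorbed by the intersection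
over `ε` on one side and by the limsup on the other. The limsup is taken in `EReal` so that an
unbounded sequence gets the value `⊤`, not a default real number. -/
theorem lemma3 (n : ℕ) (ρ : ℝ) (hρ : 0 < ρ) (p p' : ℝ → ℝ) (hp : IsProximateOrder p ρ)
    (hp' : IsNormalization p' p ρ) (σ : ℝ) (hσ : 0 ≤ σ)
    (f : EuclideanSpace ℝ (Fin (n + 1)) → Cl n) (hf : IsLeftMonogenic f) :
    f ∈ growthSpacePlus n p σ ↔
      limsup (fun q : ℕ => (((supHomPart f q * growthCoeff p' ρ q) ^ (ρ / (q : ℝ)) : ℝ) : EReal))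
        atTop ≤ (σ : EReal) := by
  simp only [growthSpacePlus, Set.mem_iInter]
  constructor
  · intro h
    refine le_of_forall_gt_imp_ge_of_dense fun b hb => ?_
    obtain ⟨σ', h1, h2⟩ := EReal.lt_iff_exists_real_btwn.mp hb
    have h1' : σ < σ' := by exact_mod_cast h1
    refine le_trans (limsup_le_of_le (by isBoundedDefault) ?_) h2.le
    -- The midpoint of `σ` and `σ'` is positive even for `σ = 0`, as the estimate requires.
    filter_upwards [eventually_homPart_growth_le hρ hp' (σ := σ + (σ' - σ) / 2) (σ' := σ')
      (by linarith) (by linarith) (h _ (by linarith))] with q hq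
    exact_mod_cast hq
  · intro h ε hε
    have hlt : (σ : EReal) < ((σ + ε / 2 : ℝ) : EReal) := by
      exact_mod_cast (by linarith : σ < σ + ε / 2)
    refine mem_growthSpace_of_eventually hρ hp' (σ := σ + ε / 2) (by linarith) (by linarith) hf ?_
    filter_upwards [eventually_lt_of_limsup_lt (h.trans_lt hlt)] with q hq
    exact_mod_cast hq.le
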